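/- A unit disk graph is a graph whose vertices can be assigned closed disks of diameter 1 in the Euclidean plane such that two distinct vertices are adjacent if and only if their disks intersect. In a graph $G=(V,E)$, an edge $e$ ev-dominates a vertex $v$ if $v$ is an endpoint of $e$ or of an edge sharing a vertex with $e$. An edge-vertex dominating set (EVDS) of $G$ is a set of edges $S\subseteq E$ such that every vertex is ev-dominated by at least one edge of $S$; $\gamma_{ev}(G)$ denotes the minimum cardinality of an EVDS. **Theorem.** There is an absolute constant $C>0$ such that for every real $\varepsilon>0$ there is an algorithm with the following property. Given (by its adjacency matrix, without a disk representation) any unit disk graph $G$ with $n$ vertices and no isolated vertex, it outputs an EVDS $S$ of $G$ with $$|S|\le (1+\varepsilon)\,\gamma_{ev}(G)$$ after at most $\max(n,2)^{\,C(1+c^2)}$ steps, where $c=\frac1\varepsilon\log\frac1\varepsilon$. In particular, for $0<\varepsilon\le \frac12$ the running time is $n^{O(c^2)}$ for $n\geq 2$, with an absolute implied constant. Here algorithms are programs of a unit-cost random access machine over the natural numbers whose arithmetic operations are addition and truncated subtraction. -/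

import Mathlib

/-! ### Unit disk graphs -/

/-- `G` is a unit disk graph: to every vertex one can assign a (closed) disk of diameter `1` in the
Euclidean plane so that distinct vertices are adjacent exactly when their disks intersect. -/
def IsUnitDiskGraph {V : Type*} (G : SimpleGraph V) : Prop :=
  ∃ p : V → EuclideanSpace ℝ (Fin 2), ∀ u v : V,
    G.Adj u v ↔
      u ≠ v ∧ (Metric.closedBall (p u) (1 / 2) ∩ Metric.closedBall (p v) (1 / 2)).Nonempty

/-! ### Edge-vertex domination -/

/-- The edges of `G` adjacent to `e`, i.e. the other edges that share a vertex with `e`. -/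
def edgeNeighborhood {V : Type*} (G : SimpleGraph V) (e : Sym2 V) : Set (Sym2 V) :=
  {f | f ∈ G.edgeSet ∧ f ≠ e ∧ ∃ w, w ∈ e ∧ w ∈ f}

/-- The edge `e` ev-dominates the vertex `v`: `v` is incident to `e` or to an edge adjacent
to `e`. -/
def EvDominates {V : Type*} (G : SimpleGraph V) (e : Sym2 V) (v : V) : Prop :=
  v ∈ e ∨ ∃ f ∈ edgeNeighborhood G e, v ∈ f

/-- `S` is an edge-vertex dominating set of `G`: a set of edges of `G` such that every vertex
is ev-dominated by at least one of them. -/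
def IsEVDS {V : Type*} (G : SimpleGraph V) (S : Finset (Sym2 V)) : Prop :=
  (∀ e ∈ S, e ∈ G.edgeSet) ∧ ∀ v : V, ∃ e ∈ S, EvDominates G e v

/-- The ev-domination number, the least size of an edge-vertex dominating set
(meaningful for finite graphs without isolated vertices, which have one). -/
noncomputable def evDominationNumber {V : Type*} (G : SimpleGraph V) : ℕ :=
  sInf {k : ℕ | ∃ S : Finset (Sym2 V), IsEVDS G S ∧ S.card = k}

/-! ### The machine model

Structured programs for a random access machine over the natural numbers, with finitely many
variables and arrays per program, in the unit-cost model whose only arithmetic operations are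
addition and truncated subtraction (so that numbers gain at most one bit per unit of time, and
the model is polynomially equivalent to Turing machines). -/

namespace RAM

/-- Contents of the variables and of the arrays. -/
structure State where
  var : ℕ → ℕ
  arr : ℕ → ℕ → ℕ

/-- Expressions: constants, variables, array entries `a[e]`, sums, truncated differences. -/
inductive Expr where
  | const (k : ℕ) : Expr
  | var (x : ℕ) : Expr
  | read (a : ℕ) (e : Expr) : Expr
  | add (e₁ e₂ : Expr) : Expr
  | sub (e₁ e₂ : Expr) : Expr

/-- The value of an expression. -/
def Expr.eval (st : State) : Expr → ℕ
  | .const k => k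
  | .var x => st.var x
  | .read a e => st.arr a (e.eval st)
  | .add e₁ e₂ => e₁.eval st + e₂.eval st
  | .sub e₁ e₂ => e₁.eval st - e₂.eval st

/-- The time to evaluate an expression: one unit per constant, variable, array access and
arithmetic operation. -/
def Expr.cost : Expr → ℕ
  | .const _ => 1
  | .var _ => 1
  | .read _ e => e.cost + 1
  | .add e₁ e₂ => e₁.cost + e₂.cost + 1
  | .sub e₁ e₂ => e₁.cost + e₂.cost + 1

/-- Programs. `assign x e` is `x := e`, `write a e₁ e₂` is `a[e₁] := e₂`; the test of `ite` and
`loop` (a while loop) succeeds when the expression is nonzero. -/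
inductive Prog where
  | nop : Prog
  | assign (x : ℕ) (e : Expr) : Prog
  | write (a : ℕ) (e₁ e₂ : Expr) : Prog
  | seq (p q : Prog) : Prog
  | ite (e : Expr) (p q : Prog) : Prog
  | loop (e : Expr) (p : Prog) : Prog

/-- The state after setting variable `x` to `k`. -/
def State.setVar (st : State) (x k : ℕ) : State where
  var := Function.update st.var x k
  arr := st.arr

/-- The state after setting entry `i` of array `a` to `k`. -/
def State.setArr (st : State) (a i k : ℕ) : State where
  var := st.var
  arr := Function.update st.arr a (Function.update (st.arr a) i k)

/-- `Exec p st t st'`: started in `st`, the program `p` halts after exactly `t` units of time,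
in state `st'`. Every assignment and every test costs one unit plus its expressions. -/
inductive Exec : Prog → State → ℕ → State → Prop where
  | nop (st : State) : Exec .nop st 1 st
  | assign (st : State) (x : ℕ) (e : Expr) :
      Exec (.assign x e) st (e.cost + 1) (st.setVar x (e.eval st))
  | write (st : State) (a : ℕ) (e₁ e₂ : Expr) :
      Exec (.write a e₁ e₂) st (e₁.cost + e₂.cost + 1) (st.setArr a (e₁.eval st) (e₂.eval st))
  | seq {p q : Prog} {st₁ st₂ st₃ : State} {s t : ℕ} :
      Exec p st₁ s st₂ → Exec q st₂ t st₃ → Exec (.seq p q) st₁ (s + t) st₃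
  | iteTrue {e : Expr} {p q : Prog} {st st' : State} {t : ℕ} :
      e.eval st ≠ 0 → Exec p st t st' → Exec (.ite e p q) st (e.cost + 1 + t) st'
  | iteFalse {e : Expr} {p q : Prog} {st st' : State} {t : ℕ} :
      e.eval st = 0 → Exec q st t st' → Exec (.ite e p q) st (e.cost + 1 + t) st'
  | loopDone {e : Expr} {p : Prog} {st : State} :
      e.eval st = 0 → Exec (.loop e p) st (e.cost + 1) st
  | loopStep {e : Expr} {p : Prog} {st₁ st₂ st₃ : State} {s t : ℕ} :
      e.eval st₁ ≠ 0 → Exec p st₁ s st₂ → Exec (.loop e p) st₂ t st₃ →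
      Exec (.loop e p) st₁ (e.cost + 1 + s + t) st₃

open Classical in
/-- The initial state on input a graph on `n` labelled vertices: variable `0` holds `n`, array `0`
holds the adjacency matrix row by row, and everything else is `0`. -/
noncomputable def inputState {n : ℕ} (G : SimpleGraph (Fin n)) : State where
  var x := if x = 0 then n else 0
  arr a k :=
    if a = 0 ∧ ∃ u v : Fin n, k = (u : ℕ) * n + (v : ℕ) ∧ G.Adj u v then 1 else 0

/-- The state `st` presents `S` as output: variable `1` holds the length of a list of pairs of
vertices, arrays `1` and `2` hold the first and the second components of these pairs, and `S` is
the set of the corresponding unordered pairs. -/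
def State.Outputs {n : ℕ} (st : State) (S : Finset (Sym2 (Fin n))) : Prop :=
  ∃ e : Fin (st.var 1) → Fin n × Fin n,
    (∀ i : Fin (st.var 1), st.arr 1 i = ((e i).1 : ℕ) ∧ st.arr 2 i = ((e i).2 : ℕ)) ∧
    ∀ x : Sym2 (Fin n), x ∈ S ↔ ∃ i : Fin (st.var 1), x = s((e i).1, (e i).2)

/-- On input `G`, the program `P` outputs the edge set `S` after exactly `t` units of time. -/
def Computes {n : ℕ} (P : Prog) (G : SimpleGraph (Fin n)) (S : Finset (Sym2 (Fin n)))
    (t : ℕ) : Prop :=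
  ∃ st : State, Exec P (inputState G) t st ∧ st.Outputs S

end RAM

namespace RAM

/-! ### A program logic with running times bounded by powers -/

/-! The algorithm is greedy ball growing around unmarked vertices. Let `v` be unmarked, let `U` be
the set of unmarked vertices, and let `g j` be the least number of edges that ev-dominate the part
of `U` within distance `3 j` of `v`. A maximal independent subset of that part, with one incident
edge chosen at each of its vertices, dominates it; in a unit disk graph such a set has at most `(12
j + 1) ^ 2` elements, because they lie in different cells of a grid of mesh one half. Hence `g`
grows only polynomially and cannot gain a factor larger than `1 + 1 / m` at each of the first
`numRadii m = O(m log m)` steps (`exists_slow_growth`). At some radius, therefore, `k = g j` and `k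
+ k / m` edges suffice for radius `3 j + 3` (`exists_radius`). Such edges are output, and the ball
of radius `3 j + 3` is marked.

The approximation ratio comes from a charging argument (`Inv.committed`). Fix any EVDS `O`. At least
`k` of its edges dominate an unmarked vertex within distance `3 j`, and everything such an edge
dominates lies within distance `3 j + 3`, hence is marked afterwards. So different rounds charge
disjoint sets of edges of `O`, and the output has at most `(1 + 1 / m) |O|` edges; take `O` minimum
and `m ≥ 1 / ε`.

No disk representation enters the program: geometry only bounds the radii and sizes that must be
tried. Those finitely many pairs `(j, k)` depend on `m` alone, so they are unrolled in the program
text. Each is decided by exhaustive search over at most `2 k` edges, that is, by nested loops over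
their ends. With `k ≤ maxSize m = O((m log m) ^ 2)` this gives the exponent `O(1 + c ^ 2)`. -/

@[simp] theorem State.setVar_arr (st : State) (x k : ℕ) : (st.setVar x k).arr = st.arr := rfl

@[simp] theorem State.setArr_var (st : State) (a i k : ℕ) : (st.setArr a i k).var = st.var := rfl

@[simp] theorem State.setVar_var (st : State) (x k y : ℕ) :
    (st.setVar x k).var y = if y = x then k else st.var y := by
  simp [State.setVar, Function.update_apply]

@[simp] theorem State.setArr_arr (st : State) (a i k b j : ℕ) :
    (st.setArr a i k).arr b j = if b = a ∧ j = i then k else st.arr b j := by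
  by_cases h : b = a
  · subst h; simp [State.setArr, Function.update_apply]
  · simp [State.setArr, h]

/-- Started in a state satisfying `P`, the program `p` halts within `N ^ a` units of time in a
state satisfying `Q`. -/
def Hoare (N : ℕ) (P : State → Prop) (p : Prog) (a : ℕ) (Q : State → Prop) : Prop :=
  ∀ st, P st → ∃ st' t, Exec p st t st' ∧ t ≤ N ^ a ∧ Q st'

section Rules

variable {N : ℕ} {P P' Q Q' M : State → Prop} {p q : Prog} {a b : ℕ}

theorem Hoare.conseq (hN : 2 ≤ N) (h : Hoare N P p a Q) (hab : a ≤ b) (hP : ∀ st, P' st → P st)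
    (hQ : ∀ st, Q st → Q' st) : Hoare N P' p b Q' := by
  intro st hst
  obtain ⟨st', t, he, ht, hq⟩ := h st (hP st hst)
  exact ⟨st', t, he, ht.trans (Nat.pow_le_pow_right (by omega) hab), hQ _ hq⟩

theorem Hoare.nop (hN : 2 ≤ N) (h : ∀ st, P st → Q st) : Hoare N P .nop a Q := fun st hst =>
  ⟨st, 1, .nop st, Nat.one_le_pow _ _ (by omega), h st hst⟩

theorem Hoare.assign (hN : 2 ≤ N) {x : ℕ} {e : Expr} (hc : e.cost + 1 ≤ 2 ^ a)
    (h : ∀ st, P st → Q (st.setVar x (e.eval st))) : Hoare N P (.assign x e) a Q := fun st hst =>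
  ⟨_, _, .assign st x e, hc.trans (Nat.pow_le_pow_left hN a), h st hst⟩

theorem Hoare.write (hN : 2 ≤ N) {c : ℕ} {e₁ e₂ : Expr} (hc : e₁.cost + e₂.cost + 1 ≤ 2 ^ a)
    (h : ∀ st, P st → Q (st.setArr c (e₁.eval st) (e₂.eval st))) :
    Hoare N P (.write c e₁ e₂) a Q := fun st hst =>
  ⟨_, _, .write st c e₁ e₂, hc.trans (Nat.pow_le_pow_left hN a), h st hst⟩

/-- Since `N ≥ 2`, a sum of two times bounded by `N ^ d` is at most `N ^ (d + 1)`. Only exponents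
are tracked; constant factors are absorbed into them. -/
theorem Hoare.seq (hN : 2 ≤ N) {c : ℕ} (hp : Hoare N P p a M) (hq : Hoare N M q b Q) (hac : a < c)
    (hbc : b < c) : Hoare N P (.seq p q) c Q := by
  intro st hst
  obtain ⟨st₁, s, he₁, hs, hm⟩ := hp st hst
  obtain ⟨st₂, t, he₂, ht, hQ⟩ := hq st₁ hm
  refine ⟨st₂, s + t, .seq he₁ he₂, ?_, hQ⟩
  obtain ⟨d, rfl⟩ : ∃ d, c = d + 1 := ⟨c - 1, by omega⟩
  have h1 := hs.trans (Nat.pow_le_pow_right (show 0 < N by omega) (show a ≤ d by omega))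
  have h2 := ht.trans (Nat.pow_le_pow_right (show 0 < N by omega) (show b ≤ d by omega))
  calc s + t ≤ N ^ d * 2 := by omega
    _ ≤ N ^ (d + 1) := by rw [pow_succ]; gcongr

theorem Hoare.ite (hN : 2 ≤ N) {e : Expr} (hc : e.cost + 1 ≤ 2 ^ a)
    (hp : Hoare N (fun st => P st ∧ e.eval st ≠ 0) p a Q)
    (hq : Hoare N (fun st => P st ∧ e.eval st = 0) q a Q) : Hoare N P (.ite e p q) (a + 1) Q := by
  have key : ∀ t, t ≤ N ^ a → e.cost + 1 + t ≤ N ^ (a + 1) := by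
    intro t ht
    have := hc.trans (Nat.pow_le_pow_left hN a)
    calc e.cost + 1 + t ≤ N ^ a * 2 := by omega
      _ ≤ N ^ (a + 1) := by rw [pow_succ]; gcongr
  intro st hst
  by_cases h : e.eval st = 0
  · obtain ⟨st', t, he, ht, hQ⟩ := hq st ⟨hst, h⟩
    exact ⟨st', _, .iteFalse h he, key t ht, hQ⟩
  · obtain ⟨st', t, he, ht, hQ⟩ := hp st ⟨hst, h⟩
    exact ⟨st', _, .iteTrue h he, key t ht, hQ⟩

/-- `for x < n do body`, where `n` is the value of variable `0`. -/
def forLt (x : ℕ) (body : Prog) : Prog :=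
  .seq (.assign x (.const 0))
    (.loop (.sub (.var 0) (.var x)) (.seq body (.assign x (.add (.var x) (.const 1)))))

/-- The at most `N` rounds cost one in the exponent. The overhead of tests and increments is a
factor below `2 ^ 4 ≤ N ^ 4`, which costs four more. -/
theorem Hoare.forLt (hN : 2 ≤ N) {n x : ℕ} (hn : n ≤ N) {body : Prog} (I : ℕ → State → Prop)
    (hsize : ∀ j st, I j st → st.var 0 = n) (hI : ∀ j st k, I j st → I j (st.setVar x k))
    (hbody : ∀ j : Fin n, Hoare N (fun st => I j st ∧ st.var x = j) body a
      (fun st => I (j + 1) st ∧ st.var x = j)) :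
    Hoare N (I 0) (RAM.forLt x body) (a + 5) (I n) := by
  have main : ∀ d j st, j + d = n → I j st → st.var x = j → ∃ st' t,
      Exec (.loop (.sub (.var 0) (.var x)) (.seq body (.assign x (.add (.var x) (.const 1)))))
        st t st' ∧ t ≤ d * (N ^ a + 8) + 4 ∧ I n st' := by
    intro d
    induction d with
    | zero =>
      intro j st hj hst hv
      refine ⟨st, _, .loopDone ?_, ?_, ?_⟩
      · simp only [Expr.eval, hsize j st hst, hv]; omega
      · simp [Expr.cost]
      · obtain rfl : j = n := by omega
        exact hst
    | succ d ih =>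
      intro j st hj hst hv
      obtain ⟨st₁, s, he, hs, h1, h2⟩ := hbody ⟨j, by omega⟩ st ⟨hst, hv⟩
      obtain ⟨st₂, t, he', ht, h3⟩ := ih (j + 1) (st₁.setVar x (j + 1)) (by omega)
        (hI _ _ _ h1) (by simp)
      have h4 : (Expr.add (.var x) (.const 1)).eval st₁ = j + 1 := by
        simp only [Expr.eval]; simpa using h2
      have h5 := Exec.assign st₁ x (.add (.var x) (.const 1))
      rw [h4] at h5
      refine ⟨st₂, _, .loopStep ?_ (.seq he h5) he', ?_, h3⟩
      · simp only [Expr.eval, hsize j st hst, hv]; omega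
      · simp only [Expr.cost, Nat.add_mul]; omega
  intro st hst
  obtain ⟨st', t, he, ht, h⟩ := main n 0 (st.setVar x 0) (by omega) (hI _ _ _ hst) (by simp)
  refine ⟨st', _, .seq (.assign st x (.const 0)) he, ?_, h⟩
  have h1 : 1 ≤ N ^ a := Nat.one_le_pow _ _ (by omega)
  have h2 : n * (N ^ a + 8) ≤ N * (N ^ a * 9) := Nat.mul_le_mul hn (by omega)
  have h3 : N ^ a ≤ N * N ^ a := Nat.le_mul_of_pos_left _ (by omega)
  have h4 : N ^ (a + 5) = N ^ 4 * (N * N ^ a) := by ring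
  have h5 : 2 ^ 4 ≤ N ^ 4 := Nat.pow_le_pow_left hN 4
  have h6 := Nat.mul_le_mul_right (N * N ^ a) h5
  simp only [Expr.cost]
  have h7 : N * (N ^ a * 9) = 9 * (N * N ^ a) := by ring
  omega

/-- The rule for loops whose invariant depends on the set of indices that have been visited. -/
theorem Hoare.forSet (hN : 2 ≤ N) {n x : ℕ} (hn : n ≤ N) {body : Prog}
    (I : Set (Fin n) → State → Prop)
    (hsize : ∀ T st, I T st → st.var 0 = n) (hI : ∀ T st k, I T st → I T (st.setVar x k))
    (hbody : ∀ (j : Fin n) (T : Set (Fin n)), Hoare N (fun st => I T st ∧ st.var x = j) body a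
      (fun st => I (insert j T) st ∧ st.var x = j)) :
    Hoare N (I ∅) (RAM.forLt x body) (a + 5) (I Set.univ) := by
  have := Hoare.forLt (a := a) hN hn (body := body) (fun j => I {i | (i : ℕ) < j})
    (fun j st => hsize _ st) (fun j st k => hI _ st k) (by
      intro j
      have h := hbody j {i | (i : ℕ) < j}
      convert h using 4
      ext i
      simp only [Set.mem_ofPred_eq, Set.mem_insert_iff, Fin.ext_iff]
      omega)
  convert this using 2
  · simp
  · ext i; simp

/-- Run a list of programs one after the other. -/
def seqList : List Prog → Prog
  | [] => .nop
  | p :: l => .seq p (seqList l)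

theorem Hoare.seqList (hN : 2 ≤ N) {α : Type*} (f : α → Prog) (l : List α)
    (J : List α → State → Prop)
    (h : ∀ l₁ x l₂, l = l₁ ++ x :: l₂ → Hoare N (J l₁) (f x) a (J (l₁ ++ [x])))
    (hb : l.length < 2 ^ b) : Hoare N (J []) (RAM.seqList (l.map f)) (a + b) (J l) := by
  have main : ∀ l₂ l₁, l = l₁ ++ l₂ → ∀ st, J l₁ st → ∃ st' t,
      Exec (RAM.seqList (l₂.map f)) st t st' ∧ t ≤ l₂.length * N ^ a + 1 ∧ J l st' := by
    intro l₂
    induction l₂ with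
    | nil => 
      intro l₁ hl st hst
      exact ⟨st, 1, .nop st, by simp, by simpa [hl] using hst⟩
    | cons x l₂ ih =>
      intro l₁ hl st hst
      obtain ⟨st₁, s, he, hs, h1⟩ := h l₁ x l₂ hl st hst
      obtain ⟨st₂, t, he', ht, h2⟩ := ih (l₁ ++ [x]) (by simp [hl]) st₁ h1
      refine ⟨st₂, s + t, .seq he he', ?_, h2⟩
      simp only [List.length_cons, Nat.add_mul]; omega
  intro st hst
  obtain ⟨st', t, he, ht, h'⟩ := main l [] rfl st hst
  refine ⟨st', t, he, ht.trans ?_, h'⟩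
  calc l.length * N ^ a + 1 ≤ (l.length + 1) * N ^ a := by
        have : 1 ≤ N ^ a := Nat.one_le_pow _ _ (by omega)
        rw [Nat.add_mul]; omega
    _ ≤ 2 ^ b * N ^ a := Nat.mul_le_mul_right _ hb
    _ ≤ N ^ b * N ^ a := Nat.mul_le_mul_right _ (Nat.pow_le_pow_left hN b)
    _ = N ^ (a + b) := by ring

end Rules

end RAM

/-! ### Balls, domination and packing in unit disk graphs -/

section Graph

variable {V : Type*} (G : SimpleGraph V)

/-- Closed adjacency. -/
def Near (u w : V) : Prop := u = w ∨ G.Adj u w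

/-- `Ball G r u w` says that the distance of `u` and `w` is at most `r`. -/
def Ball : ℕ → V → V → Prop
  | 0, u, w => u = w
  | r + 1, u, w => ∃ x, Ball r u x ∧ Near G x w

/-- The edge with the given ends ev-dominates `w`. -/
def Dom (e : V × V) (w : V) : Prop := Near G e.1 w ∨ Near G e.2 w

/-- Some `k` edges ev-dominate the set `W`. -/
def CanDominate (W : Set V) (k : ℕ) : Prop :=
  ∃ t : ℕ → V × V, (∀ i < k, G.Adj (t i).1 (t i).2) ∧ ∀ w ∈ W, ∃ i < k, Dom G (t i) w

variable {G}

theorem Near.symm {u w : V} (h : Near G u w) : Near G w u := h.imp Eq.symm fun h => h.symm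

theorem Ball.self (r : ℕ) (u : V) : Ball G r u u := by
  induction r with
  | zero => rfl
  | succ r ih => exact ⟨u, ih, .inl rfl⟩

theorem ball_one {u w : V} : Ball G 1 u w ↔ Near G u w := by
  simp [Ball]

theorem evDominates_iff {a b w : V} (hab : G.Adj a b) :
    EvDominates G s(a, b) w ↔ Dom G (a, b) w := by
  constructor
  · rintro (h | ⟨f, ⟨hf, -, x, hx, hxf⟩, hw⟩)
    · rcases Sym2.mem_iff.1 h with rfl | rfl
      · exact .inl (.inl rfl)
      · exact .inr (.inl rfl)
    · have key : Near G x w := by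
        by_cases hxw : x = w
        · exact .inl hxw
        · rw [(Sym2.mem_and_mem_iff hxw).1 ⟨hxf, hw⟩] at hf
          exact .inr hf
      rcases Sym2.mem_iff.1 hx with rfl | rfl
      · exact .inl key
      · exact .inr key
  · have key : ∀ x, x ∈ s(a, b) → Near G x w → EvDominates G s(a, b) w := by
      rintro x hx (rfl | h)
      · exact .inl hx
      · by_cases hw : w ∈ s(a, b)
        · exact .inl hw
        · exact .inr ⟨s(x, w), ⟨h, fun h' => hw (h' ▸ Sym2.mem_mk_right x w), x, hx,
            Sym2.mem_mk_left x w⟩, Sym2.mem_mk_right x w⟩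
    rintro (h | h)
    · exact key a (Sym2.mem_mk_left a b) h
    · exact key b (Sym2.mem_mk_right a b) h

/-- One step leads from `x` to an end of `e`, a second possibly to the other end, a third to `w`.
This is why the radii advance by three. -/
theorem Ball.of_evDominates {r : ℕ} {v x w : V} {e : Sym2 V} (he : e ∈ G.edgeSet)
    (hv : Ball G r v x) (hx : EvDominates G e x) (hw : EvDominates G e w) :
    Ball G (r + 3) v w := by
  induction e with
  | h a b =>
    have hab : G.Adj a b := he
    rw [evDominates_iff hab] at hx hw
    have key : ∀ c d, Near G c x → Near G c d → Near G d w → Ball G (r + 3) v w :=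
      fun c d h1 h2 h3 => ⟨d, ⟨c, ⟨x, hv, h1.symm⟩, h2⟩, h3⟩
    rcases hx with hx | hx <;> rcases hw with hw | hw
    · exact key a a hx (.inl rfl) hw
    · exact key a b hx (.inr hab) hw
    · exact key b a hx (.inr hab.symm) hw
    · exact key b b hx (.inl rfl) hw

/-- The list is padded by repeating its first edge, which requires `0 < k`. -/
theorem CanDominate.mono {W : Set V} {k l : ℕ} (h : CanDominate G W k) (hk : 0 < k) (hkl : k ≤ l) :
    CanDominate G W l := by
  obtain ⟨t, h1, h2⟩ := h
  refine ⟨fun i => if i < k then t i else t 0, fun i _ => ?_, fun w hw => ?_⟩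
  · by_cases h : i < k
    · simpa [h] using h1 i h
    · simpa [h] using h1 0 hk
  · obtain ⟨i, hi, h⟩ := h2 w hw
    exact ⟨i, by omega, by simpa [hi] using h⟩

theorem CanDominate.of_finset {W : Set V} {k : ℕ} {E : Finset (Sym2 V)} (hne : E.Nonempty)
    (hE : ∀ e ∈ E, e ∈ G.edgeSet) (hk : E.card ≤ k) (hW : ∀ w ∈ W, ∃ e ∈ E, EvDominates G e w) :
    CanDominate G W k := by
  obtain ⟨e₀, he₀⟩ := hne
  have hout : ∀ e : Sym2 V, s((Quot.out e).1, (Quot.out e).2) = e := fun e => Quot.out_eq e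
  refine ⟨fun i => Quot.out (E.toList.getD i e₀), fun i _ => ?_, fun w hw => ?_⟩
  · rw [← SimpleGraph.mem_edgeSet, hout]
    apply hE
    by_cases h : i < E.toList.length
    · rw [List.getD_eq_getElem _ _ h]
      exact Finset.mem_toList.1 (List.getElem_mem h)
    · rwa [List.getD_eq_default _ _ (by omega)]
  · obtain ⟨e, he, hd⟩ := hW w hw
    obtain ⟨i, hi, rfl⟩ := List.mem_iff_getElem.1 (Finset.mem_toList.2 he)
    refine ⟨i, by simp at hi; omega, ?_⟩
    simp only [List.getD_eq_getElem _ _ hi]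
    have hadj : G.Adj (Quot.out E.toList[i]).1 (Quot.out E.toList[i]).2 := by
      rw [← SimpleGraph.mem_edgeSet, hout]; exact hE _ he
    have := evDominates_iff (w := w) hadj
    rw [hout] at this
    exact this.1 hd

/-- A failed search for `k - 1` edges becomes a lower bound for every dominating edge set.
Nonemptiness of `W` supplies an edge with which a smaller set can be padded. -/
theorem le_card_of_not_canDominate {W : Set V} (hW : W.Nonempty) {k : ℕ}
    (h : ¬ CanDominate G W (k - 1)) {E : Finset (Sym2 V)} (hE : ∀ e ∈ E, e ∈ G.edgeSet)
    (hd : ∀ w ∈ W, ∃ e ∈ E, EvDominates G e w) : k ≤ E.card := by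
  by_contra hk
  obtain ⟨w, hw⟩ := hW
  obtain ⟨e, he, -⟩ := hd w hw
  exact h (.of_finset ⟨e, he⟩ hE (by omega) hd)

theorem exists_maximal_independent [Finite V] (W : Set V) : ∃ I : Finset V,
    (∀ x ∈ I, x ∈ W) ∧ (∀ x ∈ I, ∀ y ∈ I, ¬ G.Adj x y) ∧ ∀ w ∈ W, ∃ x ∈ I, Near G x w := by
  classical
  obtain ⟨I, ⟨h1, h2⟩, hmax⟩ := Set.Finite.exists_maximal
    (s := {I : Finset V | (∀ x ∈ I, x ∈ W) ∧ ∀ x ∈ I, ∀ y ∈ I, ¬ G.Adj x y})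
    (Set.toFinite _) ⟨∅, by simp⟩
  refine ⟨I, h1, h2, fun w hw => ?_⟩
  by_contra! hn
  have hw' : w ∉ I := fun h => hn w h (.inl rfl)
  refine hw' (hmax (y := insert w I) ⟨?_, ?_⟩ (Finset.subset_insert w I)
    (Finset.mem_insert_self w I))
  · simpa [hw] using h1
  · intro x hx y hy
    rcases Finset.mem_insert.1 hx with rfl | hx' <;> rcases Finset.mem_insert.1 hy with rfl | hy'
    · exact G.irrefl
    · exact fun h => hn y hy' (.inr h.symm)
    · exact fun h => hn x hx' (.inr h)
    · exact h2 x hx' y hy'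

theorem Ball.dist_le {p : V → EuclideanSpace ℝ (Fin 2)}
    (hp : ∀ u v, G.Adj u v → dist (p u) (p v) ≤ 1)
    {r : ℕ} {u w : V} (h : Ball G r u w) : dist (p u) (p w) ≤ r := by
  induction r generalizing w with
  | zero => obtain rfl : u = w := h; simp
  | succ r ih =>
    obtain ⟨x, hx, rfl | hxw⟩ := h
    · have := ih hx
      push_cast; linarith
    · have := ih hx
      have := hp _ _ hxw
      have := dist_triangle (p u) (p x) (p w)
      push_cast; linarith

theorem dist_lt_one_of_floor_eq {c x y : EuclideanSpace ℝ (Fin 2)}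
    (h : ∀ i, ⌊2 * (x i - c i)⌋ = ⌊2 * (y i - c i)⌋) : dist x y < 1 := by
  have key : ∀ i, (x i - y i) ^ 2 < 1 / 4 := by
    intro i
    have := Int.abs_sub_lt_one_of_floor_eq_floor (h i)
    rw [abs_lt] at this
    nlinarith [this.1, this.2]
  rw [EuclideanSpace.dist_eq, Real.sqrt_lt' one_pos]
  simp only [Fin.sum_univ_two, Real.dist_eq, sq_abs]
  linarith [key 0, key 1]

/-- The square grid of mesh `1 / 2` anchored at `p v` has `4 r + 1` relevant cells in each
direction. Two points in one cell are at distance less than `1`, hence adjacent if distinct, so an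
independent set meets each cell at most once. -/
theorem card_le_of_independent (hG : IsUnitDiskGraph G) {r : ℕ} {v : V} {I : Finset V}
    (hI : ∀ x ∈ I, Ball G r v x) (hind : ∀ x ∈ I, ∀ y ∈ I, ¬ G.Adj x y) :
    I.card ≤ (4 * r + 1) ^ 2 := by
  obtain ⟨p, hp⟩ := hG
  have hadj : ∀ u v, G.Adj u v → dist (p u) (p v) ≤ 1 := by
    intro u v h
    obtain ⟨z, hz1, hz2⟩ := ((hp u v).1 h).2
    have := dist_triangle_left (p u) (p v) z
    rw [Metric.mem_closedBall] at hz1 hz2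
    linarith
  have hnadj : ∀ u v, u ≠ v → dist (p u) (p v) ≤ 1 → G.Adj u v := by
    intro u v huv h
    refine (hp u v).2 ⟨huv, midpoint ℝ (p u) (p v), ?_, ?_⟩
    · rw [Metric.mem_closedBall, dist_midpoint_left]
      norm_num; linarith
    · rw [Metric.mem_closedBall, dist_midpoint_right]
      norm_num; linarith
  let f : V → ℤ × ℤ := fun x => (⌊2 * (p x 0 - p v 0)⌋, ⌊2 * (p x 1 - p v 1)⌋)
  have hcoord : ∀ x ∈ I, ∀ i, ⌊2 * (p x i - p v i)⌋ ∈ Finset.Icc (-(2 * r : ℤ)) (2 * r) := by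
    intro x hx i
    have h1 := (hI x hx).dist_le hadj
    have h2 : |p x i - p v i| ≤ r := by
      rw [dist_comm, dist_eq_norm] at h1
      exact (PiLp.norm_apply_le (p x - p v) i).trans h1
    rw [abs_le] at h2
    rw [Finset.mem_Icc, Int.le_floor]
    constructor
    · push_cast; linarith
    · rw [← Int.lt_add_one_iff, Int.floor_lt]; push_cast; linarith
  have hmaps : Set.MapsTo f I
      (Finset.Icc (-(2 * r : ℤ)) (2 * r) ×ˢ Finset.Icc (-(2 * r : ℤ)) (2 * r) :
      Finset (ℤ × ℤ)) := by
    intro x hx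
    exact Finset.mem_coe.2 (Finset.mem_product.2 ⟨hcoord x hx 0, hcoord x hx 1⟩)
  have hinj : Set.InjOn f I := by
    intro x hx y hy hxy
    by_contra hne
    refine hind x hx y hy (hnadj x y hne (dist_lt_one_of_floor_eq (c := p v) ?_).le)
    intro i
    fin_cases i
    · exact congrArg Prod.fst hxy
    · exact congrArg Prod.snd hxy
  refine (Finset.card_le_card_of_injOn f hmaps hinj).trans ?_
  rw [Finset.card_product, Int.card_Icc, sq]
  have : (2 * (r : ℤ) + 1 - -(2 * r)).toNat = 4 * r + 1 := by omega
  rw [this]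

/-- A maximal independent subset of `W` dominates `W`. An arbitrary incident edge at each of its
vertices does so too, and packing bounds their number. -/
theorem canDominate_of_subset_ball [Finite V] (hG : IsUnitDiskGraph G) (hiso : ∀ v, ∃ w, G.Adj v w)
    {r : ℕ} {v : V} {W : Set V} (hne : W.Nonempty) (hW : ∀ w ∈ W, Ball G r v w) :
    CanDominate G W ((4 * r + 1) ^ 2) := by
  classical
  choose f hf using hiso
  obtain ⟨I, h1, h2, h3⟩ := exists_maximal_independent (G := G) W
  obtain ⟨w, hw⟩ := hne
  obtain ⟨x, hx, -⟩ := h3 w hw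
  refine .of_finset (E := I.image fun x => s(x, f x)) ⟨_, Finset.mem_image_of_mem _ hx⟩ ?_
    (Finset.card_image_le.trans (card_le_of_independent hG (fun x hx => hW x (h1 x hx)) h2)) ?_
  · intro e he
    obtain ⟨x, -, rfl⟩ := Finset.mem_image.1 he
    exact hf x
  · intro w hw
    obtain ⟨x, hx, hxw⟩ := h3 w hw
    exact ⟨_, Finset.mem_image_of_mem _ hx, (evDominates_iff (hf x)).2 (.inl hxw)⟩

end Graph

/-! ### Slow growth -/

/-- The number of radii that are tried for the growth rate `1 + 1 / m`. -/
def numRadii (m : ℕ) : ℕ := 21 * (m * (Nat.log 2 m + 1))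

/-- Since `(1 + 1 / m) ^ m ≥ 2`, the exponential side gains at least `2 ^ (21 L)`, while `m < 2 ^ L`
and `L < 2 ^ L` keep the polynomial side below that. -/
theorem growth_lt {m : ℕ} (hm : 2 ≤ m) :
    m ^ numRadii m * (12 * numRadii m + 1) ^ 2 < (m + 1) ^ numRadii m := by
  set L := Nat.log 2 m + 1 with hL
  have hmL : m < 2 ^ L := Nat.lt_pow_succ_log_self one_lt_two m
  have hJ : numRadii m = m * (21 * L) := by rw [numRadii]; ring
  have h1 : m ^ m * 2 ≤ (m + 1) ^ m := by
    obtain ⟨d, rfl⟩ : ∃ d, m = d + 1 := ⟨m - 1, by omega⟩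
    have h := add_pow (d + 1) 1 (d + 1)
    rw [Finset.sum_range_succ, Finset.sum_range_succ] at h
    simp only [one_pow, Nat.choose_succ_self_right, Nat.choose_self, mul_one, Nat.cast_id] at h
    have : (d + 1) ^ d * (d + 1) = (d + 1) ^ (d + 1) := by ring
    omega
  have h2 : (12 * numRadii m + 1) ^ 2 < 2 ^ (21 * L) := by
    have hL2 : L < 2 ^ L := Nat.lt_two_pow_self
    have hpos : 1 ≤ L := by omega
    have h3 : m * L ≤ 2 ^ L * 2 ^ L := Nat.mul_le_mul hmL.le hL2.le
    have h4 : 12 * numRadii m + 1 < 273 * (m * L) := by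
      rw [hJ]; nlinarith
    calc (12 * numRadii m + 1) ^ 2 < (273 * (m * L)) ^ 2 := Nat.pow_lt_pow_left h4 two_ne_zero
      _ ≤ (273 * (2 ^ L * 2 ^ L)) ^ 2 := by gcongr
      _ = 74529 * 2 ^ (4 * L) := by ring
      -- The constant `21` in `numRadii` is `17 + 4`: seventeen bits hold `273 ^ 2 = 74529`, and
      -- four factors `2 ^ L` come from `(m * L) ^ 2`.
      _ ≤ 2 ^ (17 * L) * 2 ^ (4 * L) := by
        gcongr
        calc 74529 ≤ 2 ^ (17 * 1) := by norm_num
          _ ≤ 2 ^ (17 * L) := Nat.pow_le_pow_right two_pos (by omega)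
      _ = 2 ^ (21 * L) := by ring
  calc m ^ numRadii m * (12 * numRadii m + 1) ^ 2 < m ^ numRadii m * 2 ^ (21 * L) :=
        Nat.mul_lt_mul_of_pos_left h2 (by positivity)
    _ = (m ^ m * 2) ^ (21 * L) := by rw [hJ, pow_mul _ m, mul_pow]
    _ ≤ ((m + 1) ^ m) ^ (21 * L) := Nat.pow_le_pow_left h1 _
    _ = (m + 1) ^ numRadii m := by rw [hJ, pow_mul _ m]

/-- If every step multiplied `g` by more than `1 + 1 / m`, then `g (numRadii m)` would exceed its
quadratic bound by `growth_lt`. -/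
theorem exists_slow_growth {m : ℕ} (hm : 2 ≤ m) (g : ℕ → ℕ) (h0 : 1 ≤ g 0)
    (hg : ∀ j, g j ≤ (12 * j + 1) ^ 2) : ∃ j < numRadii m, m * g (j + 1) ≤ (m + 1) * g j := by
  by_contra! h
  have key : ∀ j ≤ numRadii m, (m + 1) ^ j ≤ m ^ j * g j := by
    intro j
    induction j with
    | zero => simpa using h0
    | succ j ih =>
      intro hj
      calc (m + 1) ^ (j + 1) = (m + 1) * (m + 1) ^ j := by ring
        _ ≤ (m + 1) * (m ^ j * g j) := Nat.mul_le_mul_left _ (ih (by omega))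
        _ = m ^ j * ((m + 1) * g j) := by ring
        _ ≤ m ^ j * (m * g (j + 1)) := Nat.mul_le_mul_left _ (h j (by omega)).le
        _ = m ^ (j + 1) * g (j + 1) := by ring
  have h1 := key _ le_rfl
  have h2 := Nat.mul_le_mul_left (m ^ numRadii m) (hg (numRadii m))
  have h3 := growth_lt hm
  omega

/-- The largest size of an optimum for a ball that has to be considered. -/
def maxSize (m : ℕ) : ℕ := (12 * numRadii m + 1) ^ 2

/-- The witness is a radius of slow growth with `k` the exact optimum there. The conclusion is
weakened to what the program can test; any pair passing the test serves the charging argument. -/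
theorem exists_radius {V : Type*} [Finite V] {G : SimpleGraph V} (hG : IsUnitDiskGraph G)
    (hiso : ∀ v, ∃ w, G.Adj v w) {m : ℕ} (hm : 2 ≤ m) (v : V) (U : Set V) (hv : v ∈ U) :
    ∃ j < numRadii m, ∃ k < maxSize m + 1,
      ¬ CanDominate G {w | Ball G (3 * j) v w ∧ w ∈ U} (k - 1) ∧
      CanDominate G {w | Ball G (3 * j + 3) v w ∧ w ∈ U} (k + k / m) := by
  classical
  have hne : ∀ r, {w | Ball G r v w ∧ w ∈ U}.Nonempty := fun r => ⟨v, Ball.self r v, hv⟩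
  have hex : ∀ j, CanDominate G {w | Ball G (3 * j) v w ∧ w ∈ U} ((12 * j + 1) ^ 2) := by
    intro j
    have := canDominate_of_subset_ball hG hiso (hne (3 * j)) (fun w hw => hw.1)
    convert this using 2
    ring
  let g : ℕ → ℕ := fun j => Nat.find ⟨_, hex j⟩
  have hgs : ∀ j, CanDominate G {w | Ball G (3 * j) v w ∧ w ∈ U} (g j) :=
    fun j => Nat.find_spec ⟨_, hex j⟩
  have hg1 : ∀ j, 1 ≤ g j := by
    intro j
    by_contra h0
    obtain ⟨t, -, h⟩ := hgs j
    obtain ⟨w, hw⟩ := hne (3 * j)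
    obtain ⟨i, hi, -⟩ := h w hw
    omega
  have hgle : ∀ j, g j ≤ (12 * j + 1) ^ 2 := fun j => Nat.find_min' ⟨_, hex j⟩ (hex j)
  obtain ⟨j, hj, hjm⟩ := exists_slow_growth hm g (hg1 0) hgle
  refine ⟨j, hj, g j, ?_, Nat.find_min ⟨_, hex j⟩ (Nat.sub_lt (hg1 j) one_pos), ?_⟩
  · have : (12 * j + 1) ^ 2 ≤ maxSize m := by unfold maxSize; gcongr
    have := hgle j
    omega
  · refine (hgs (j + 1)).mono (hg1 _) ?_
    -- Integrality of `g (j + 1)` allows rounding down, so the budget is exactly `k + k / m`.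
    have : g (j + 1) ≤ ((m + 1) * g j) / m := (Nat.le_div_iff_mul_le (by omega)).2 (by linarith)
    have h2 : (m + 1) * g j = g j + m * g j := by ring
    rw [h2, Nat.add_mul_div_left _ _ (by omega)] at this
    omega

namespace RAM

/-! ### Frozen initial states, truth values and matrix indices -/

theorem Hoare.of_forall {N : ℕ} {P Q : State → Prop} {p : Prog} {a : ℕ}
    (h : ∀ st, P st → Hoare N (fun st' => st' = st) p a Q) : Hoare N P p a Q :=
  fun st hst => h st hst st rfl

/-- The number `x` is the truth value of `p`. -/
def Bit (x : ℕ) (p : Prop) : Prop := p ∧ x = 1 ∨ ¬ p ∧ x = 0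

theorem Bit.congr {x : ℕ} {p q : Prop} (h : Bit x p) (hpq : p ↔ q) : Bit x q := by
  rwa [← propext hpq]

theorem index_inj {n : ℕ} {u v u' v' : Fin n} :
    (u : ℕ) * n + v = u' * n + v' ↔ u = u' ∧ v = v' := by
  refine ⟨fun h => ?_, by rintro ⟨rfl, rfl⟩; rfl⟩
  have hn : 0 < n := u.pos
  have h1 := congrArg (· % n) h
  have h2 := congrArg (· / n) h
  simp only [Nat.mul_comm _ n, Nat.mul_add_mod, Nat.mod_eq_of_lt v.isLt, Nat.mod_eq_of_lt v'.isLt,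
    Nat.mul_add_div hn, Nat.div_eq_of_lt v.isLt, Nat.div_eq_of_lt v'.isLt] at h1 h2
  exact ⟨Fin.ext (by omega), Fin.ext h1⟩

/-! ### Precomputed data

Array `3` holds the offsets of the rows of a matrix, array `4` marks the vertices that are already
dominated, and array `5 + r` is the matrix of the balls of radius `r`. -/

/-- The data that the program does not change after its first phase. -/
structure Static {n : ℕ} (G : SimpleGraph (Fin n)) (R : ℕ) (st : State) : Prop where
  size : st.var 0 = n
  adj : ∀ u v : Fin n, Bit (st.arr 0 (u * n + v)) (G.Adj u v)
  row : ∀ u : Fin n, st.arr 3 u = u * n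
  ball : ∀ r ≤ R, ∀ u v : Fin n, Bit (st.arr (5 + r) (u * n + v)) (Ball G r u v)

section

variable {n : ℕ} {G : SimpleGraph (Fin n)} {R : ℕ}

theorem Static.congr {st st' : State} (h : Static G R st) (h0 : st'.var 0 = st.var 0)
    (ha : ∀ a, a ≠ 1 → a ≠ 2 → a ≠ 4 → a ≤ 5 + R → st'.arr a = st.arr a) : Static G R st' where
  size := h0.trans h.size
  adj := by rw [ha 0 (by omega) (by omega) (by omega) (by omega)]; exact h.adj
  row := by rw [ha 3 (by omega) (by omega) (by omega) (by omega)]; exact h.row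
  ball r hr := by
    rw [ha (5 + r) (by omega) (by omega) (by omega) (by omega)]; exact h.ball r hr

theorem Static.setVar {st : State} (h : Static G R st) {x : ℕ} (hx : x ≠ 0) (k : ℕ) :
    Static G R (st.setVar x k) :=
  h.congr (by simp [hx.symm]) (by simp)

/-- The entry in row `x` and column `y` of the matrix `a`. -/
def entry (a x y : ℕ) : Expr := .read a (.add (.read 3 (.var x)) (.var y))

/-- The machine cannot multiply, so the offset `u * n` is looked up in array `3`, which was filled
by repeated addition. -/
theorem entry_eval {st : State} (h : Static G R st) {x y : ℕ} {u v : Fin n} (hx : st.var x = u)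
    (hy : st.var y = v) (a : ℕ) : (entry a x y).eval st = st.arr a (u * n + v) := by
  simp [entry, Expr.eval, hx, hy, h.row]

/-- Fill the array of row offsets and the identity matrix. -/
def initProg : Prog :=
  .seq (.assign 2 (.const 0)) (forLt 5 (.seq (.write 3 (.var 5) (.var 2))
    (.seq (.write 5 (.add (.var 2) (.var 5)) (.const 1)) (.assign 2 (.add (.var 2) (.var 0))))))

/-- No balls of radius greater than `R` have been computed, and no output has been written. -/
structure Fresh (R : ℕ) (st : State) : Prop where
  count : st.var 1 = 0
  covered : ∀ k, st.arr 4 k = 0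
  later : ∀ a, 5 + R < a → ∀ k, st.arr a k = 0

theorem initProg_spec {N : ℕ} (hN : 2 ≤ N) (hn : n ≤ N) :
    Hoare N (fun st => st = inputState G) initProg 20
      (fun st => Static G 0 st ∧ Fresh 0 st) := by
  let I : ℕ → State → Prop := fun j st => Fresh 0 st ∧ st.var 0 = n ∧ st.var 2 = j * n ∧
    (∀ u v : Fin n, Bit (st.arr 0 (u * n + v)) (G.Adj u v)) ∧
    (∀ u : Fin n, u < j → st.arr 3 u = u * n) ∧
    ∀ u v : Fin n, Bit (st.arr 5 (u * n + v)) (u < j ∧ u = v)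
  have hloop : Hoare N (I 0) (forLt 5 (.seq (.write 3 (.var 5) (.var 2))
    (.seq (.write 5 (.add (.var 2) (.var 5)) (.const 1)) (.assign 2 (.add (.var 2) (.var 0))))))
      (6 + 5) (I n) := by
    refine Hoare.forLt hN hn I (fun j st h => h.2.1) ?_ ?_
    · rintro j st k ⟨⟨h1, h2, h3⟩, h4, h5, h6⟩
      exact ⟨⟨by simpa using h1, h2, h3⟩, by simpa using h4, by simpa using h5, h6⟩
    · intro j
      let M₁ : State → Prop := fun st => Fresh 0 st ∧ st.var 0 = n ∧ st.var 2 = j * n ∧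
        (∀ u v : Fin n, Bit (st.arr 0 (u * n + v)) (G.Adj u v)) ∧
        (∀ u : Fin n, (u : ℕ) < j + 1 → st.arr 3 u = u * n) ∧
        (∀ u v : Fin n, Bit (st.arr 5 (u * n + v)) (u < j ∧ u = v)) ∧ st.var 5 = j
      let M₂ : State → Prop := fun st => Fresh 0 st ∧ st.var 0 = n ∧ st.var 2 = j * n ∧
        (∀ u v : Fin n, Bit (st.arr 0 (u * n + v)) (G.Adj u v)) ∧
        (∀ u : Fin n, (u : ℕ) < j + 1 → st.arr 3 u = u * n) ∧
        (∀ u v : Fin n, Bit (st.arr 5 (u * n + v)) ((u : ℕ) < j + 1 ∧ u = v)) ∧ st.var 5 = j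
      refine Hoare.seq (M := M₁) (a := 3) (b := 5) hN (.write hN (by decide) ?_) (.seq (M := M₂)
        (a := 3) (b := 3) hN (.write hN (by decide) ?_) (.assign hN (by decide) ?_)
        (by omega) (by omega)) (by omega) (by omega)
      · rintro st ⟨⟨⟨h1, h2, h3⟩, h4, h5, h6, h7, h8⟩, h9⟩
        refine ⟨⟨by simpa using h1, by simpa using h2, ?_⟩, h4, h5, by simpa using h6, ?_,
          by simpa using h8, h9⟩
        · intro a ha k
          have : a ≠ 3 := by omega
          simpa [this] using h3 a ha k
        · intro u hu
          by_cases huj : (u : ℕ) = j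
          · simp [Expr.eval, h5, h9, huj]
          · simpa [Expr.eval, h9, huj] using h7 u (by omega)
      · rintro st ⟨⟨h1, h2, h3⟩, h4, h5, h6, h7, h8, h9⟩
        refine ⟨⟨by simpa using h1, by simpa using h2, ?_⟩, h4, h5, by simpa using h6,
          by simpa using h7, ?_, h9⟩
        · intro a ha k
          have : a ≠ 5 := by omega
          simpa [this] using h3 a ha k
        · intro u v
          simp only [State.setArr_arr, Expr.eval, h5, h9, true_and, index_inj]
          split_ifs with h
          · obtain ⟨rfl, rfl⟩ := h
            exact .inl ⟨⟨by omega, rfl⟩, rfl⟩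
          · refine (h8 u v).congr ?_
            constructor
            · exact fun h => ⟨by have := h.1; omega, h.2⟩
            · rintro ⟨h1, rfl⟩
              refine ⟨?_, rfl⟩
              have : (u : ℕ) ≠ j := fun h' => h ⟨Fin.ext h', Fin.ext h'⟩
              omega
      · rintro st ⟨⟨h1, h2, h3⟩, h4, h5, h6, h7, h8, h9⟩
        refine ⟨⟨⟨by simpa using h1, h2, h3⟩, by simpa using h4, ?_, h6, h7, h8⟩, by simpa using h9⟩
        simp only [State.setVar_var, Expr.eval, h4, h5, if_true]
        ring
  refine Hoare.seq (M := I 0) (a := 2) (b := 11) hN (.assign hN (by decide) ?_)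
    (hloop.conseq hN le_rfl (fun _ h => h) ?_) (by omega) (by omega)
  · rintro st rfl
    refine ⟨⟨by simp [inputState], by simp [inputState], fun a ha k => ?_⟩, by simp [inputState],
      by simp [Expr.eval], fun u v => ?_, by simp, fun u v => ?_⟩
    · have : a ≠ 0 := by omega
      simp [inputState, this]
    · have : (∃ u' v' : Fin n, (u : ℕ) * n + v = u' * n + v' ∧ G.Adj u' v') ↔ G.Adj u v := by
        constructor
        · rintro ⟨u', v', h, h'⟩
          obtain ⟨rfl, rfl⟩ := index_inj.1 h
          exact h'
        · exact fun h => ⟨u, v, rfl, h⟩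
      by_cases h : G.Adj u v
      · exact .inl ⟨h, by simp [inputState, this, h]⟩
      · exact .inr ⟨h, by simp [inputState, this, h]⟩
    · exact .inr ⟨by simp, by simp [inputState]⟩
  · rintro st ⟨h1, h2, h3, h4, h5, h6⟩
    refine ⟨⟨h2, h4, fun u => h5 u u.isLt, fun r hr u v => ?_⟩, h1⟩
    obtain rfl : r = 0 := by omega
    exact (h6 u v).congr (by simp [Ball])

/-- Compute the balls of radius `r + 1` from those of radius `r`. -/
def ballStep (r : ℕ) : Prog :=
  forLt 3 (forLt 5 (forLt 4 (.ite
    (.sub (entry (5 + r) 3 5) (.sub (.const 1) (.add (entry 0 5 4) (entry 5 5 4))))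
    (.write (6 + r) (.add (.read 3 (.var 3)) (.var 4)) (.const 1)) .nop)))

/-- The state while the balls of radius `R + 1` are computed, after the triples in `Q` have been
inspected. -/
structure BallInv (G : SimpleGraph (Fin n)) (R : ℕ) (Q : Fin n → Fin n → Fin n → Prop)
    (st : State) : Prop where
  static : Static G R st
  fresh : Fresh (R + 1) st
  bits : ∀ v w : Fin n, Bit (st.arr (6 + R) (v * n + w)) (∃ u, Q v u w ∧ Ball G R v u ∧ Near G u w)

theorem BallInv.setVar {Q : Fin n → Fin n → Fin n → Prop} {st : State} (h : BallInv G R Q st)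
    {x : ℕ} (hx : 1 < x) (k : ℕ) : BallInv G R Q (st.setVar x k) where
  static := h.static.setVar (by omega) k
  fresh := ⟨by simpa [show 1 ≠ x by omega] using h.fresh.count, h.fresh.covered, h.fresh.later⟩
  bits := h.bits

/-- The invariant records in `Q` which triples `(v, u, w)` have been inspected. The loops enlarge
`Q` by a single triple, a row, and a slab in turn, until `Q` is everything. -/
theorem ballStep_spec {N : ℕ} (hN : 2 ≤ N) (hn : n ≤ N) :
    Hoare N (fun st => Static G R st ∧ Fresh R st) (ballStep R) 21
      (fun st => Static G (R + 1) st ∧ Fresh (R + 1) st) := by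
  have hcell : ∀ (v u w : Fin n) (Q : Fin n → Fin n → Fin n → Prop), Hoare N
      (fun st => BallInv G R Q st ∧ st.var 3 = v ∧ st.var 5 = u ∧ st.var 4 = w)
      (.ite (.sub (entry (5 + R) 3 5) (.sub (.const 1) (.add (entry 0 5 4) (entry 5 5 4))))
        (.write (6 + R) (.add (.read 3 (.var 3)) (.var 4)) (.const 1)) .nop) 6
      (fun st => BallInv G R (fun v' u' w' => Q v' u' w' ∨ v' = v ∧ u' = u ∧ w' = w) st ∧
        st.var 3 = v ∧ st.var 5 = u ∧ st.var 4 = w) := by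
    intro v u w Q
    -- Truncated subtraction serves as logic: `a - (1 - b)` with a bit `a` is nonzero iff both `a`
    -- and `b` are. Array `5`, the balls of radius `0`, provides the equality test in `Near`.
    have hcond : ∀ st, BallInv G R Q st ∧ st.var 3 = v ∧ st.var 5 = u ∧ st.var 4 = w →
        ((Expr.sub (entry (5 + R) 3 5)
          (.sub (.const 1) (.add (entry 0 5 4) (entry 5 5 4)))).eval st ≠ 0 ↔
          Ball G R v u ∧ Near G u w) := by
      rintro st ⟨h, h3, h5, h4⟩
      simp only [Expr.eval, entry_eval h.static h3 h5, entry_eval h.static h5 h4]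
      have h0 := h.static.ball 0 (Nat.zero_le _) u w
      have hu : Near G u w ↔ Ball G 0 u w ∨ G.Adj u w := Iff.rfl
      rw [hu]
      rcases h.static.ball R le_rfl v u with ⟨k1, e1⟩ | ⟨k1, e1⟩ <;>
        rcases h.static.adj u w with ⟨k2, e2⟩ | ⟨k2, e2⟩ <;>
        rcases h0 with ⟨k3, e3⟩ | ⟨k3, e3⟩ <;> simp_all
    refine Hoare.ite hN (by simp [Expr.cost, entry]) (.write hN (by simp [Expr.cost]) ?_)
      (.nop hN ?_)
    · rintro st ⟨hst, hc⟩
      rw [hcond st hst] at hc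
      obtain ⟨h, h3, h5, h4⟩ := hst
      refine ⟨⟨h.static.congr rfl fun a _ _ _ ha => ?_, ⟨h.fresh.count, ?_, ?_⟩, ?_⟩, h3, h5, h4⟩
      · funext k
        simp [show a ≠ 6 + R by omega]
      · intro k
        simpa [show 4 ≠ 6 + R by omega] using h.fresh.covered k
      · intro a ha k
        simpa [show a ≠ 6 + R by omega] using h.fresh.later a ha k
      · intro v' w'
        simp only [State.setArr_arr, Expr.eval, h3, h4, h.static.row, true_and, index_inj]
        split_ifs with he
        · obtain ⟨rfl, rfl⟩ := he
          exact .inl ⟨⟨u, .inr ⟨rfl, rfl, rfl⟩, hc⟩, rfl⟩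
        · refine (h.bits v' w').congr (exists_congr fun u' => and_congr_left fun _ => ?_)
          exact ⟨.inl, fun hq => hq.resolve_right fun hq' => he ⟨hq'.1, hq'.2.2⟩⟩
    · rintro st ⟨hst, hc⟩
      have hc' := mt (hcond st hst).2 (not_not.2 hc)
      obtain ⟨h, h3, h5, h4⟩ := hst
      refine ⟨⟨h.static, h.fresh, fun v' w' => ?_⟩, h3, h5, h4⟩
      refine (h.bits v' w').congr (exists_congr fun u' => and_congr_left fun hb => ?_)
      refine ⟨.inl, fun hq => hq.resolve_right ?_⟩
      rintro ⟨rfl, rfl, rfl⟩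
      exact hc' hb
  have hrow : ∀ (v u : Fin n) (Q : Fin n → Fin n → Fin n → Prop), Hoare N
      (fun st => BallInv G R Q st ∧ st.var 3 = v ∧ st.var 5 = u)
      (forLt 4 (.ite (.sub (entry (5 + R) 3 5) (.sub (.const 1) (.add (entry 0 5 4) (entry 5 5 4))))
        (.write (6 + R) (.add (.read 3 (.var 3)) (.var 4)) (.const 1)) .nop)) 11
      (fun st => BallInv G R (fun v' u' w' => Q v' u' w' ∨ v' = v ∧ u' = u) st ∧
        st.var 3 = v ∧ st.var 5 = u) := by
    intro v u Q
    refine (Hoare.forSet (a := 6) hN hn (fun T st =>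
      BallInv G R (fun v' u' w' => Q v' u' w' ∨ v' = v ∧ u' = u ∧ w' ∈ T) st ∧
        st.var 3 = v ∧ st.var 5 = u) (fun T st h => h.1.static.size)
        (fun T st k h => ⟨h.1.setVar (by omega) k, by simpa using h.2⟩) ?_).conseq hN (by omega)
        (by simp) (by simp)
    intro w T
    refine (hcell v u w (fun v' u' w' => Q v' u' w' ∨ v' = v ∧ u' = u ∧ w' ∈ T)).conseq hN le_rfl
      (fun st h => ⟨h.1.1, h.1.2.1, h.1.2.2, h.2⟩) fun st h => ⟨⟨?_, h.2.1, h.2.2.1⟩, h.2.2.2⟩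
    convert h.1 using 4
    simp only [Set.mem_insert_iff]
    tauto
  have hmat : ∀ (v : Fin n) (Q : Fin n → Fin n → Fin n → Prop), Hoare N
      (fun st => BallInv G R Q st ∧ st.var 3 = v)
      (forLt 5 (forLt 4 (.ite
        (.sub (entry (5 + R) 3 5) (.sub (.const 1) (.add (entry 0 5 4) (entry 5 5 4))))
        (.write (6 + R) (.add (.read 3 (.var 3)) (.var 4)) (.const 1)) .nop))) 16
      (fun st => BallInv G R (fun v' u' w' => Q v' u' w' ∨ v' = v) st ∧ st.var 3 = v) := by
    intro v Q
    refine (Hoare.forSet (a := 11) hN hn (fun T st =>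
      BallInv G R (fun v' u' w' => Q v' u' w' ∨ v' = v ∧ u' ∈ T) st ∧
        st.var 3 = v) (fun T st h => h.1.static.size)
        (fun T st k h => ⟨h.1.setVar (by omega) k, by simpa using h.2⟩) ?_).conseq hN (by omega)
        (by simp) (by simp)
    intro u T
    refine (hrow v u (fun v' u' w' => Q v' u' w' ∨ v' = v ∧ u' ∈ T)).conseq hN le_rfl
      (fun st h => ⟨h.1.1, h.1.2, h.2⟩) fun st h => ⟨⟨?_, h.2.1⟩, h.2.2⟩
    convert h.1 using 4
    simp only [Set.mem_insert_iff]
    tauto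
  refine (Hoare.forSet (a := 16) hN hn (fun T st => BallInv G R (fun v' u' w' => v' ∈ T) st)
    (fun T st h => h.static.size) (fun T st k h => h.setVar (by omega) k) ?_).conseq hN
      (by omega) ?_ ?_
  · intro v T
    refine (hmat v fun v' u' w' => v' ∈ T).conseq hN le_rfl (fun st h => h) fun st h => ⟨?_, h.2⟩
    convert h.1 using 4
    simp only [Set.mem_insert_iff]
    tauto
  · rintro st ⟨h, hf⟩
    exact ⟨h, ⟨hf.count, hf.covered, fun a ha k => hf.later a (by omega) k⟩, fun v w =>
      .inr ⟨by simp, hf.later _ (by omega) _⟩⟩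
  · intro st h
    refine ⟨⟨h.static.size, h.static.adj, h.static.row, fun r hr u w => ?_⟩, h.fresh⟩
    rcases Nat.le_succ_iff.1 hr with hr | rfl
    · exact h.static.ball r hr u w
    · have := (h.bits u w).congr (q := Ball G (R + 1) u w) (by simp [Ball])
      rwa [show 6 + R = 5 + R.succ by omega] at this

end

end RAM

namespace RAM

/-! ### Exhaustive search for an edge-vertex dominating set of a ball

Variables `10 + 2 i` and `11 + 2 i` hold the ends of the `i`-th edge. -/

section

variable {n : ℕ} {G : SimpleGraph (Fin n)} {R : ℕ}

/-- The edges with numbers between `d` and `k` are those of `t`. -/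
def Holds (d k : ℕ) (t : ℕ → Fin n × Fin n) (st : State) : Prop :=
  ∀ i, d ≤ i → i < k → st.var (10 + 2 * i) = (t i).1 ∧ st.var (11 + 2 * i) = (t i).2

theorem Holds.setVar {d k : ℕ} {t : ℕ → Fin n × Fin n} {st : State} (h : Holds d k t st) {x : ℕ}
    (hx : x < 10 + 2 * d) (c : ℕ) : Holds d k t (st.setVar x c) := by
  intro i hi hik
  simpa [show 10 + 2 * i ≠ x by omega, show 11 + 2 * i ≠ x by omega] using h i hi hik

/-- Run `leaf` for all values of the first `d` edges. -/
def search : ℕ → Prog → Prog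
  | 0, leaf => leaf
  | d + 1, leaf => forLt (10 + 2 * d) (forLt (11 + 2 * d)
      (.ite (entry 0 (10 + 2 * d) (11 + 2 * d)) (search d leaf) .nop))

/-- `J F` is meant as an invariant saying that `F` forces the success flag to be set, whence its
antitonicity in `F`. The search enlarges `F` by the existence of a good tuple extending the edges
already fixed. Goodness is demanded of every `t''` agreeing with `t'` below `k`, since only those
entries are stored. -/
theorem search_spec {N : ℕ} (hN : 2 ≤ N) (hn : n ≤ N) {J : Prop → State → Prop} {k a : ℕ}
    {leaf : Prog} {good : (ℕ → Fin n × Fin n) → Prop}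
    (hstatic : ∀ F st, J F st → Static G R st)
    (hvar : ∀ F st x c, 10 ≤ x → J F st → J F (st.setVar x c))
    (hanti : ∀ F F' : Prop, (F' → F) → ∀ st, J F st → J F' st) (ha : 3 ≤ a)
    (hleaf : ∀ t F, (∀ i < k, G.Adj (t i).1 (t i).2) →
      Hoare N (fun st => J F st ∧ Holds 0 k t st) leaf a
        (fun st => J (F ∨ good t) st ∧ Holds 0 k t st)) :
    ∀ d ≤ k, ∀ t F, (∀ i, d ≤ i → i < k → G.Adj (t i).1 (t i).2) →
      Hoare N (fun st => J F st ∧ Holds d k t st) (search d leaf) (a + 11 * d)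
        (fun st => J (F ∨ ∃ t' : ℕ → Fin n × Fin n, (∀ i, d ≤ i → i < k → t' i = t i) ∧
          (∀ i < k, G.Adj (t' i).1 (t' i).2) ∧ ∀ t'', (∀ i < k, t'' i = t' i) → good t'') st ∧
          Holds d k t st) := by
  intro d
  induction d with
  | zero =>
    intro _ t F ht
    refine (hleaf t F fun i hi => ht i (Nat.zero_le i) hi).conseq hN le_rfl (fun st h => h)
      fun st h => ⟨hanti _ _ ?_ st h.1, h.2⟩
    rintro (h | ⟨t', h1, -, h3⟩)
    · exact .inl h
    · exact .inr (h3 t fun i hi => (h1 i (Nat.zero_le i) hi).symm)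
  | succ d ih =>
    intro hd t F ht
    -- `X B` restricts the good tuples to those whose edge number `d` satisfies `B`. The two loops
    -- enlarge `B` from one pair to a row to all pairs.
    let X : (Fin n × Fin n → Prop) → Prop := fun B =>
      ∃ t' : ℕ → Fin n × Fin n, (∀ i, d + 1 ≤ i → i < k → t' i = t i) ∧ B (t' d) ∧
          (∀ i < k, G.Adj (t' i).1 (t' i).2) ∧ ∀ t'', (∀ i < k, t'' i = t' i) → good t''
    have hbody : ∀ (u v : Fin n) F, Hoare N
        (fun st => J F st ∧ Holds (d + 1) k t st ∧ st.var (10 + 2 * d) = u ∧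
          st.var (11 + 2 * d) = v)
        (.ite (entry 0 (10 + 2 * d) (11 + 2 * d)) (search d leaf) .nop) (a + 11 * d + 1)
        (fun st => J (F ∨ X (· = (u, v))) st ∧ Holds (d + 1) k t st ∧ st.var (10 + 2 * d) = u ∧
          st.var (11 + 2 * d) = v) := by
      intro u v F
      have hcond : ∀ st, J F st ∧ Holds (d + 1) k t st ∧ st.var (10 + 2 * d) = u ∧
          st.var (11 + 2 * d) = v →
          ((entry 0 (10 + 2 * d) (11 + 2 * d)).eval st ≠ 0 ↔ G.Adj u v) := by
        rintro st ⟨hJ, -, hu, hv⟩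
        rw [entry_eval (hstatic _ _ hJ) hu hv]
        rcases (hstatic _ _ hJ).adj u v with ⟨h, e⟩ | ⟨h, e⟩ <;> simp [h, e]
      refine Hoare.ite hN ?_ ?_ (.nop hN ?_)
      · calc (entry 0 (10 + 2 * d) (11 + 2 * d)).cost + 1 ≤ 2 ^ 3 := by simp [entry, Expr.cost]
          _ ≤ 2 ^ (a + 11 * d) := Nat.pow_le_pow_right two_pos (by omega)
      · by_cases huv : G.Adj u v
        · have hup : ∀ i, d + 1 ≤ i → Function.update t d (u, v) i = t i := fun i hi =>
            Function.update_of_ne (by omega) _ _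
          refine (ih (by omega) (Function.update t d (u, v)) F ?_).conseq hN le_rfl ?_ ?_
          · intro i hi hik
            rcases Nat.eq_or_lt_of_le hi with rfl | hi
            · simpa using huv
            · rw [hup i hi]; exact ht i hi hik
          · rintro st ⟨⟨hJ, hH, hu, hv⟩, -⟩
            refine ⟨hJ, fun i hi hik => ?_⟩
            rcases Nat.eq_or_lt_of_le hi with rfl | hi
            · simpa using ⟨hu, hv⟩
            · rw [hup i hi]; exact hH i hi hik
          · rintro st ⟨hJ, hH⟩
            refine ⟨hanti _ _ ?_ st hJ, fun i hi hik => ?_, ?_⟩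
            · rintro (h | ⟨t', h1, h2, h3⟩)
              · exact .inl h
              · refine .inr ⟨t', fun i hi hik => ?_, h3⟩
                rcases Nat.eq_or_lt_of_le hi with rfl | hi
                · simpa using h2
                · rw [hup i hi]; exact h1 i hi hik
            · rw [← hup i hi]; exact hH i (by omega) hik
            · simpa using hH d le_rfl (by omega)
        · intro st hst
          exact absurd ((hcond st hst.1).1 hst.2) huv
      · rintro st ⟨hst, hc⟩
        have huv := mt (hcond st hst).2 (not_not.2 hc)
        refine ⟨hanti _ _ ?_ st hst.1, hst.2⟩
        rintro (h | ⟨t', -, h2, h3, -⟩)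
        · exact h
        · have := h3 d (by omega)
          rw [h2] at this
          exact absurd this huv
    have hinner : ∀ (u : Fin n) F, Hoare N
        (fun st => J F st ∧ Holds (d + 1) k t st ∧ st.var (10 + 2 * d) = u)
        (forLt (11 + 2 * d) (.ite (entry 0 (10 + 2 * d) (11 + 2 * d)) (search d leaf) .nop))
        (a + 11 * d + 6)
        (fun st => J (F ∨ X (·.1 = u)) st ∧ Holds (d + 1) k t st ∧ st.var (10 + 2 * d) = u) := by
      intro u F
      refine (Hoare.forSet (a := a + 11 * d + 1) hN hn (fun T st =>
        J (F ∨ X fun p => p.1 = u ∧ p.2 ∈ T) st ∧ Holds (d + 1) k t st ∧ st.var (10 + 2 * d) = u)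
        (fun T st h => (hstatic _ _ h.1).size)
        (fun T st c h => ⟨hvar _ _ _ _ (by omega) h.1, h.2.1.setVar (by omega) c,
          by simpa using h.2.2⟩) ?_).conseq hN le_rfl ?_ ?_
      · intro v T
        refine (hbody u v (F ∨ X fun p => p.1 = u ∧ p.2 ∈ T)).conseq hN le_rfl
          (fun st h => ⟨h.1.1, h.1.2.1, h.1.2.2, h.2⟩)
          fun st h => ⟨⟨hanti _ _ ?_ st h.1, h.2.1, h.2.2.1⟩, h.2.2.2⟩
        rintro (h | ⟨t', h1, ⟨h2, rfl | h3⟩, h4⟩)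
        · exact .inl (.inl h)
        · exact .inr ⟨t', h1, Prod.ext h2 rfl, h4⟩
        · exact .inl (.inr ⟨t', h1, ⟨h2, h3⟩, h4⟩)
      · rintro st ⟨h1, h2⟩
        refine ⟨hanti _ _ ?_ st h1, h2⟩
        rintro (h | ⟨t', -, ⟨-, h⟩, -⟩)
        · exact h
        · exact absurd h (Set.notMem_empty _)
      · rintro st ⟨h1, h2⟩
        refine ⟨hanti _ _ ?_ st h1, h2⟩
        rintro (h | ⟨t', h1, h2, h3⟩)
        · exact .inl h
        · exact .inr ⟨t', h1, ⟨h2, Set.mem_univ _⟩, h3⟩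
    refine (Hoare.forSet (a := a + 11 * d + 6) hN hn (fun T st =>
      J (F ∨ X fun p => p.1 ∈ T) st ∧ Holds (d + 1) k t st)
      (fun T st h => (hstatic _ _ h.1).size)
      (fun T st c h => ⟨hvar _ _ _ _ (by omega) h.1, h.2.setVar (by omega) c⟩) ?_).conseq hN
        (by omega) ?_ ?_
    · intro u T
      refine (hinner u (F ∨ X fun p => p.1 ∈ T)).conseq hN le_rfl
        (fun st h => ⟨h.1.1, h.1.2, h.2⟩)
        fun st h => ⟨⟨hanti _ _ ?_ st h.1, h.2.1⟩, h.2.2⟩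
      rintro (h | ⟨t', h1, rfl | h2, h3⟩)
      · exact .inl (.inl h)
      · exact .inr ⟨t', h1, rfl, h3⟩
      · exact .inl (.inr ⟨t', h1, h2, h3⟩)
    · rintro st ⟨h1, h2⟩
      refine ⟨hanti _ _ ?_ st h1, h2⟩
      rintro (h | ⟨t', -, h, -⟩)
      · exact h
      · exact absurd h (Set.notMem_empty _)
    · rintro st ⟨h1, h2⟩
      refine ⟨hanti _ _ ?_ st h1, h2⟩
      rintro (h | ⟨t', h1, h2, h3⟩)
      · exact .inl h
      · exact .inr ⟨t', h1, Set.mem_univ _, h2, h3⟩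

/-- The number of incidences by which the first `k` edges dominate the vertex in variable `4`. -/
def domCount : ℕ → Expr
  | 0 => .const 0
  | k + 1 => .add (.add (domCount k) (entry 6 (10 + 2 * k) 4)) (entry 6 (11 + 2 * k) 4)

theorem domCount_cost (k : ℕ) : (domCount k).cost = 12 * k + 1 := by
  induction k with
  | zero => rfl
  | succ k ih => simp only [domCount, Expr.cost, entry, ih]; omega

theorem domCount_eval_ne_zero {st : State} (h : Static G R st) (hR : 1 ≤ R) {k : ℕ}
    {t : ℕ → Fin n × Fin n} {w : Fin n} (ht : Holds 0 k t st) (hw : st.var 4 = w) :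
    (domCount k).eval st ≠ 0 ↔ ∃ i < k, Dom G (t i) w := by
  induction k with
  | zero => simp [domCount, Expr.eval]
  | succ k ih =>
    have ih := ih fun i h1 h2 => ht i h1 (by omega)
    obtain ⟨h1, h2⟩ := ht k (Nat.zero_le k) (by omega)
    have key : (∃ i < k + 1, Dom G (t i) w) ↔ (∃ i < k, Dom G (t i) w) ∨ Dom G (t k) w := by
      constructor
      · rintro ⟨i, hi, hd⟩
        rcases Nat.lt_succ_iff_lt_or_eq.1 hi with hi | rfl
        · exact .inl ⟨i, hi, hd⟩
        · exact .inr hd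
      · rintro (⟨i, hi, hd⟩ | hd)
        · exact ⟨i, by omega, hd⟩
        · exact ⟨k, by omega, hd⟩
    have hb := fun u => (h.ball 1 hR u w).congr ball_one
    rw [key, ← ih, Dom]
    simp only [domCount, Expr.eval, entry_eval h h1 hw, entry_eval h h2 hw]
    rcases hb (t k).1 with ⟨k1, e1⟩ | ⟨k1, e1⟩ <;> rcases hb (t k).2 with ⟨k2, e2⟩ | ⟨k2, e2⟩ <;>
      simp only [Nat.reduceAdd] at e1 e2 <;> simp [k1, k2, e1, e2]

/-- Set variable `6` to `1` if the first `k` edges dominate all vertices that are not marked in the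
ball of radius `r` around the vertex in variable `3`, and to `0` otherwise. -/
def test (r k : ℕ) : Prog :=
  .seq (.assign 6 (.const 1)) (forLt 4 (.ite
    (.sub (.sub (entry (5 + r) 3 4) (.read 4 (.var 4))) (domCount k)) (.assign 6 (.const 0)) .nop))

/-- The edges of `t` dominate the part of the ball of radius `r` around `v` not marked in `c`. -/
def Covers (G : SimpleGraph (Fin n)) (c : ℕ → ℕ) (v : Fin n) (r k : ℕ) (t : ℕ → Fin n × Fin n) :
    Prop :=
  ∀ w ∈ {w : Fin n | Ball G r v w ∧ c w = 0}, ∃ i < k, Dom G (t i) w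

theorem linear_le_two_pow (k : ℕ) : 12 * k + 11 ≤ 2 ^ (k + 5) := by
  have : k < 2 ^ k := Nat.lt_two_pow_self
  rw [pow_add]; omega

theorem test_spec {N : ℕ} (hN : 2 ≤ N) (hn : n ≤ N) {J : State → Prop} {c : ℕ → ℕ} {v : Fin n}
    {r k : ℕ} {t : ℕ → Fin n × Fin n} (hR : 1 ≤ R) (hr : r ≤ R)
    (hstatic : ∀ st, J st → Static G R st) (hcov : ∀ st, J st → st.arr 4 = c)
    (hv : ∀ st, J st → st.var 3 = v) (ht : ∀ st, J st → Holds 0 k t st)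
    (hvar : ∀ st x y, x = 4 ∨ x = 6 → J st → J (st.setVar x y)) :
    Hoare N J (test r k) (k + 12) (fun st => J st ∧ (st.var 6 ≠ 0 ↔ Covers G c v r k t)) := by
  let I : Set (Fin n) → State → Prop := fun T st => J st ∧
    (st.var 6 ≠ 0 ↔ ∀ w ∈ T, Ball G r v w ∧ c w = 0 → ∃ i < k, Dom G (t i) w)
  refine Hoare.seq (M := I ∅) (a := 1) (b := k + 11) hN (.assign hN (by simp [Expr.cost]) ?_)
    ((Hoare.forSet (a := k + 6) hN hn I (fun T st h => (hstatic _ h.1).size)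
      (fun T st y h => ⟨hvar _ _ _ (.inl rfl) h.1, by simpa using h.2⟩) ?_).conseq hN
        (by omega) (fun _ h => h) ?_) (by omega) (by omega)
  · exact fun st h => ⟨hvar _ _ _ (.inr rfl) h, by simp [Expr.eval]⟩
  · intro w T
    -- The expression is nonzero exactly at a counterexample: in the ball, unmarked, and dominated
    -- by none of the edges.
    have hcond : ∀ st, I T st ∧ st.var 4 = w →
        ((Expr.sub (.sub (entry (5 + r) 3 4) (.read 4 (.var 4))) (domCount k)).eval st ≠ 0 ↔
          ¬ (Ball G r v w ∧ c w = 0 → ∃ i < k, Dom G (t i) w)) := by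
      rintro st ⟨⟨h, -⟩, hw⟩
      rw [← domCount_eval_ne_zero (hstatic st h) hR (ht st h) hw]
      simp only [Expr.eval, entry_eval (hstatic st h) (hv st h) hw, hcov st h, hw]
      rcases (hstatic st h).ball r hr v w with ⟨k1, e1⟩ | ⟨k1, e1⟩
      · simp only [e1, k1, true_and]
        omega
      · simp [e1, k1]
    refine Hoare.ite hN ?_ (.assign hN ?_ ?_) (.nop hN ?_)
    · simp only [Expr.cost, entry, domCount_cost]
      have := linear_le_two_pow k
      omega
    · have := linear_le_two_pow k
      simp only [Expr.cost]
      omega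
    · rintro st ⟨hst, hc⟩
      refine ⟨⟨hvar _ _ _ (.inr rfl) hst.1.1, ?_⟩, by simpa using hst.2⟩
      have := (hcond st hst).1 hc
      simp only [State.setVar_var, Expr.eval, if_true, ne_eq, not_true, false_iff]
      exact fun h => this (h w (Set.mem_insert w T))
    · rintro st ⟨hst, hc⟩
      refine ⟨⟨hst.1.1, ?_⟩, hst.2⟩
      have := not_not.1 (mt (hcond st hst).2 (not_not.2 hc))
      rw [hst.1.2]
      simp only [Set.mem_insert_iff, forall_eq_or_imp]
      exact ⟨fun h => ⟨this, h⟩, fun h => h.2⟩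
  · exact fun st h => ⟨h.1, by simpa [Covers] using h.2⟩

/-- Unless variable `x` is set, run the test, and if it succeeds run `succ` and set `x`. -/
def leaf (x r k : ℕ) (succ : Prog) : Prog :=
  .ite (.var x) .nop (.seq (test r k) (.ite (.var 6) (.seq succ (.assign x (.const 1))) .nop))

/-- Once flag `x` is set, `hset` makes every claim `F` free, so later leaves do nothing. While it is
unset the marks are still `c`, so the test refers to the intended set. -/
theorem leaf_spec {N : ℕ} (hN : 2 ≤ N) (hn : n ≤ N) {J : Prop → State → Prop} {c : ℕ → ℕ}
    {v : Fin n} {r k x : ℕ} (hR : 1 ≤ R) (hr : r ≤ R) {succ : Prog} (hx : x = 7 ∨ x = 8)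
    (hstatic : ∀ F st, J F st → Static G R st) (hcov : ∀ F st, J F st → st.var x = 0 → st.arr 4 = c)
    (hv : ∀ F st, J F st → st.var 3 = v)
    (hvar : ∀ F st x y, x = 4 ∨ x = 6 → J F st → J F (st.setVar x y))
    (hset : ∀ F F' st, J F st → st.var x ≠ 0 → J F' st)
    (hunset : ∀ F F', (F' → F) → ∀ st, J F st → J F' st)
    {t : ℕ → Fin n × Fin n} {F : Prop}
    (hsucc : Covers G c v r k t → Hoare N (fun st => J F st ∧ Holds 0 k t st ∧ st.var x = 0)
      (.seq succ (.assign x (.const 1))) (k + 12) (fun st => J True st ∧ Holds 0 k t st)) :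
    Hoare N (fun st => J F st ∧ Holds 0 k t st) (leaf x r k succ) (k + 15)
      (fun st => J (F ∨ Covers G c v r k t) st ∧ Holds 0 k t st) := by
  refine Hoare.ite (a := k + 14) hN ?_ (.nop hN ?_) (.seq (a := k + 12) (b := k + 13) hN
    (test_spec (G := G) (J := fun st => (J F st ∧ Holds 0 k t st) ∧ (Expr.var x).eval st = 0) (t := t)
      (c := c) (v := v) hN hn hR hr
      ?_ ?_ ?_ ?_ ?_) (.ite hN ?_ ?_ (.nop hN ?_)) (by omega) (by omega))
  · have := linear_le_two_pow k
    have : 2 ^ (k + 5) ≤ 2 ^ (k + 14) := Nat.pow_le_pow_right two_pos (by omega)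
    simp only [Expr.cost]; omega
  · exact fun st h => ⟨hset _ _ _ h.1.1 h.2, h.1.2⟩
  · exact fun st h => hstatic _ _ h.1.1
  · exact fun st h => hcov _ _ h.1.1 h.2
  · exact fun st h => hv _ _ h.1.1
  · exact fun st h => h.1.2
  · intro st y z hy h
    exact ⟨⟨hvar _ _ _ _ hy h.1.1, h.1.2.setVar (by omega) _⟩,
      by simpa [Expr.eval, show x ≠ y by omega] using h.2⟩
  · have := linear_le_two_pow k
    have : 2 ^ (k + 5) ≤ 2 ^ (k + 12) := Nat.pow_le_pow_right two_pos (by omega)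
    simp only [Expr.cost]; omega
  · by_cases hc : Covers G c v r k t
    · exact (hsucc hc).conseq hN le_rfl (fun st h => ⟨h.1.1.1.1, h.1.1.1.2, h.1.1.2⟩)
        fun st h => ⟨hunset _ _ (fun _ => trivial) _ h.1, h.2⟩
    · exact fun st h => absurd (h.1.2.1 h.2) hc
  · rintro st ⟨⟨h, h6⟩, h0⟩
    refine ⟨hunset _ _ (fun hF => hF.resolve_right fun hc => ?_) _ h.1.1, h.1.2⟩
    exact h6.2 hc h0

/-! ### Writing a solution to the output -/

/-- Append the `i`-th edge to the output. -/
def appendEdge (i : ℕ) : Prog :=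
  .seq (.write 1 (.var 1) (.var (10 + 2 * i)))
    (.seq (.write 2 (.var 1) (.var (11 + 2 * i))) (.assign 1 (.add (.var 1) (.const 1))))

/-- Append the first `k` edges to the output, and mark the ball of radius `r` around the vertex in
variable `3`. -/
def commit (r k : ℕ) : Prog :=
  .seq (seqList ((List.range k).map appendEdge))
    (forLt 4 (.ite (entry (5 + r) 3 4) (.write 4 (.var 4) (.const 1)) .nop))

/-- `st` arises from `st₀` by appending `l` edges to the output and marking the vertices in `T` that
lie in the ball of radius `r` around `v`. -/
structure Committed (G : SimpleGraph (Fin n)) (v : Fin n) (r : ℕ) (t : ℕ → Fin n × Fin n)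
    (st₀ : State) (l : ℕ) (T : Set (Fin n)) (st : State) : Prop where
  vars : ∀ x, x ≠ 1 → x ≠ 4 → st.var x = st₀.var x
  arrs : ∀ a, a ≠ 1 → a ≠ 2 → a ≠ 4 → st.arr a = st₀.arr a
  count : st.var 1 = st₀.var 1 + l
  old : ∀ i < st₀.var 1, st.arr 1 i = st₀.arr 1 i ∧ st.arr 2 i = st₀.arr 2 i
  new : ∀ i < l, st.arr 1 (st₀.var 1 + i) = (t i).1 ∧ st.arr 2 (st₀.var 1 + i) = (t i).2
  marked : ∀ w : Fin n, st.arr 4 w ≠ 0 ↔ st₀.arr 4 w ≠ 0 ∨ w ∈ T ∧ Ball G r v w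

theorem appendEdge_spec {N : ℕ} (hN : 2 ≤ N) {v : Fin n} {r k l : ℕ} {t : ℕ → Fin n × Fin n}
    {st₀ : State} (ht : Holds 0 k t st₀) (hl : l < k) :
    Hoare N (Committed G v r t st₀ l ∅) (appendEdge l) 4 (Committed G v r t st₀ (l + 1) ∅) := by
  refine Hoare.seq (a := 2) (b := 3) (M := fun st => Committed G v r t st₀ l ∅ st ∧
      st.arr 1 (st₀.var 1 + l) = (t l).1) hN (.write hN (by simp [Expr.cost]) ?_)
    (.seq (a := 2) (b := 2) (M := fun st => Committed G v r t st₀ l ∅ st ∧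
      st.arr 1 (st₀.var 1 + l) = (t l).1 ∧ st.arr 2 (st₀.var 1 + l) = (t l).2) hN
        (.write hN (by simp [Expr.cost]) ?_)
      (.assign hN (by simp [Expr.cost]) ?_) (by omega) (by omega)) (by omega) (by omega)
  · intro st h
    have hv := (h.vars (10 + 2 * l) (by omega) (by omega)).trans (ht l (Nat.zero_le l) hl).1
    refine ⟨⟨h.vars, fun a h1 h2 h4 => ?_, h.count, fun i hi => ?_, fun i hi => ?_, ?_⟩, ?_⟩
    · rw [← h.arrs a h1 h2 h4]; funext i; simp [h1]
    · simpa [Expr.eval, h.count, show i ≠ st₀.var 1 + l by omega] using h.old i hi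
    · simpa [Expr.eval, h.count, show i ≠ l by omega] using h.new i hi
    · simpa using h.marked
    · simp [Expr.eval, h.count, hv]
  · rintro st ⟨h, h'⟩
    have hv := (h.vars (11 + 2 * l) (by omega) (by omega)).trans (ht l (Nat.zero_le l) hl).2
    refine ⟨⟨h.vars, fun a h1 h2 h4 => ?_, h.count, fun i hi => ?_, fun i hi => ?_, ?_⟩, ?_⟩
    · rw [← h.arrs a h1 h2 h4]; funext i; simp [h2]
    · simpa [Expr.eval, h.count, show i ≠ st₀.var 1 + l by omega] using h.old i hi
    · simpa [Expr.eval, h.count, show i ≠ l by omega] using h.new i hi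
    · simpa using h.marked
    · simp [Expr.eval, h.count, hv, h']
  · rintro st ⟨h, h1, h2⟩
    refine ⟨fun x hx h4 => ?_, h.arrs, ?_, h.old, fun i hi => ?_, h.marked⟩
    · simpa [hx] using h.vars x hx h4
    · simp [Expr.eval, h.count, add_assoc]
    · rcases Nat.lt_succ_iff_lt_or_eq.1 hi with hi | rfl
      · exact h.new i hi
      · exact ⟨h1, h2⟩

theorem commit_spec {N : ℕ} (hN : 2 ≤ N) (hn : n ≤ N) {v : Fin n} {r k : ℕ}
    {t : ℕ → Fin n × Fin n} {st₀ : State} (hs : Static G R st₀) (hr : r ≤ R) (hv : st₀.var 3 = v)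
    (ht : Holds 0 k t st₀) :
    Hoare N (fun st => st = st₀) (commit r k) (k + 10) (Committed G v r t st₀ k Set.univ) := by
  refine Hoare.seq (a := 4 + k) (b := 9) (M := Committed G v r t st₀ k ∅) hN
    ((Hoare.seqList (a := 4) (b := k) hN appendEdge (List.range k)
      (fun l => Committed G v r t st₀ l.length ∅) ?_ ?_).conseq hN le_rfl ?_ ?_)
    (.forSet hN hn (fun T => Committed G v r t st₀ k T) ?_ ?_ ?_) (by omega) (by omega)
  · intro l₁ x l₂ h
    have hx : x = l₁.length := by
      have := congrArg (fun l => l[l₁.length]?) h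
      simp only [List.getElem?_append_right le_rfl, Nat.sub_self, List.getElem?_cons_zero] at this
      rw [List.getElem?_eq_some_iff] at this
      obtain ⟨_, h⟩ := this
      simpa using h.symm
    have hl : l₁.length < k := by
      have := congrArg List.length h
      simp at this; omega
    subst hx
    simpa using appendEdge_spec hN ht hl
  · simpa using Nat.lt_two_pow_self
  · rintro st rfl
    exact ⟨fun _ _ _ => rfl, fun _ _ _ _ => rfl, rfl, fun _ _ => ⟨rfl, rfl⟩, by simp, by simp⟩
  · simp
  · exact fun T st h => (h.vars 0 (by omega) (by omega)).trans hs.size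
  · intro T st c h
    refine ⟨fun x h1 h4 => ?_, h.arrs, ?_, h.old, h.new, h.marked⟩
    · simpa [h4] using h.vars x h1 h4
    · simpa using h.count
  · intro w T
    have hcond : ∀ st, Committed G v r t st₀ k T st ∧ st.var 4 = w →
        ((entry (5 + r) 3 4).eval st ≠ 0 ↔ Ball G r v w) := by
      rintro st ⟨h, hw⟩
      have hst : Static G R st := hs.congr (h.vars 0 (by omega) (by omega))
        fun a h1 h2 h4 _ => h.arrs a h1 h2 h4
      rw [entry_eval hst ((h.vars 3 (by omega) (by omega)).trans hv) hw]
      rcases hst.ball r hr v w with ⟨k1, e1⟩ | ⟨k1, e1⟩ <;> simp [k1, e1]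
    refine Hoare.ite (a := 3) hN (by simp [Expr.cost, entry]) (.write hN (by simp [Expr.cost]) ?_)
      (.nop hN ?_)
    · rintro st ⟨⟨h, hw⟩, hc⟩
      refine ⟨⟨h.vars, fun a h1 h2 h4 => ?_, h.count, by simpa using h.old, by simpa using h.new,
        fun w' => ?_⟩, hw⟩
      · rw [← h.arrs a h1 h2 h4]; funext i; simp [h4]
      · by_cases hww : w' = w
        · subst hww
          simp [Expr.eval, hw, (hcond st ⟨h, hw⟩).1 hc]
        · have := h.marked w'
          simpa [Expr.eval, hw, Fin.val_inj, hww] using this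
    · rintro st ⟨⟨h, hw⟩, hc⟩
      have hb := mt (hcond st ⟨h, hw⟩).2 (not_not.2 hc)
      refine ⟨⟨h.vars, h.arrs, h.count, h.old, h.new, fun w' => ?_⟩, hw⟩
      rw [h.marked w', Set.mem_insert_iff]
      refine or_congr_right (and_congr_left fun hw' => ⟨.inr, fun hh => hh.resolve_left ?_⟩)
      rintro rfl
      exact hb hw'

end

end RAM

namespace RAM

section

variable {n : ℕ} {G : SimpleGraph (Fin n)} {R : ℕ}

/-- With no edge prescribed, the search runs through all tuples of `k` edges, so a good leaf exists
iff `CanDominate` holds. -/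
theorem search_leaf_spec {N : ℕ} (hN : 2 ≤ N) (hn : n ≤ N) {J : Prop → State → Prop} {c : ℕ → ℕ}
    {v : Fin n} {r k x : ℕ} (hR : 1 ≤ R) (hr : r ≤ R) {succ : Prog} (hx : x = 7 ∨ x = 8)
    (hstatic : ∀ F st, J F st → Static G R st) (hcov : ∀ F st, J F st → st.var x = 0 → st.arr 4 = c)
    (hv : ∀ F st, J F st → st.var 3 = v)
    (hvar : ∀ F st x y, x = 4 ∨ x = 6 ∨ 10 ≤ x → J F st → J F (st.setVar x y))
    (hset : ∀ F F' st, J F st → st.var x ≠ 0 → J F' st)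
    (hanti : ∀ F F' : Prop, (F' → F) → ∀ st, J F st → J F' st) (F : Prop)
    (hsucc : ∀ t F, (∀ i < k, G.Adj (t i).1 (t i).2) → Covers G c v r k t →
      Hoare N (fun st => J F st ∧ Holds 0 k t st ∧ st.var x = 0)
        (.seq succ (.assign x (.const 1))) (k + 12) (fun st => J True st ∧ Holds 0 k t st)) :
    Hoare N (J F) (search k (leaf x r k succ)) (12 * k + 15)
      (J (F ∨ CanDominate G {w | Ball G r v w ∧ c w = 0} k)) := by
  have h := search_spec (k := k) (a := k + 15) hN hn hstatic
    (fun F st x y h => hvar F st x y (.inr (.inr h))) hanti (by omega)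
    (fun t F ht => leaf_spec hN hn hR hr hx hstatic hcov hv
      (fun F st x y h => hvar F st x y (by omega)) hset hanti fun hc => hsucc t F ht hc) k le_rfl
    -- A dummy tuple: at depth `k` none of its entries is constrained.
    (fun _ => (v, v)) F (fun i h1 h2 => absurd h2 (by omega))
  refine h.conseq hN (by omega) (fun st h => ⟨h, fun i h1 h2 => absurd h2 (by omega)⟩)
    fun st h => hanti _ _ ?_ _ h.1
  refine Or.imp_right ?_
  rintro ⟨t, h1, h2⟩
  refine ⟨t, fun i h1 h2 => absurd h2 (by omega), h1, fun t' ht w hw => ?_⟩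
  obtain ⟨i, hi, hd⟩ := h2 w hw
  exact ⟨i, hi, by rwa [ht i hi]⟩

/-! ### The approximation algorithm -/

/-- The output consists of edges, dominates all marked vertices, and is paid for by a set of edges
of `O` that dominate marked vertices only. -/
structure Inv (G : SimpleGraph (Fin n)) (m : ℕ) (O : Finset (Sym2 (Fin n))) (st : State) :
    Prop where
  charge : ∃ X ⊆ O, st.var 1 * m ≤ (m + 1) * X.card ∧
    ∀ e ∈ X, ∀ w : Fin n, EvDominates G e w → st.arr 4 w ≠ 0
  edges : ∀ i < st.var 1, ∃ a b : Fin n, st.arr 1 i = a ∧ st.arr 2 i = b ∧ G.Adj a b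
  dom : ∀ w : Fin n, st.arr 4 w ≠ 0 → ∃ i < st.var 1, ∃ a b : Fin n,
    st.arr 1 i = a ∧ st.arr 2 i = b ∧ Dom G (a, b) w

variable {m : ℕ} {O : Finset (Sym2 (Fin n))}

theorem Inv.setVar {st : State} (h : Inv G m O st) {x : ℕ} (hx : x ≠ 1) (k : ℕ) :
    Inv G m O (st.setVar x k) where
  charge := by simpa [hx.symm] using h.charge
  edges := by simpa [hx.symm] using h.edges
  dom := by simpa [hx.symm] using h.dom

/-- The new edges are charged to the members of `O` that dominate an unmarked vertex of the inner
ball. There are at least `k` of them, none charged before, and all they dominate is marked now. The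
ratio persists because `(k + k / m) * m ≤ (m + 1) * k`. -/
theorem Inv.committed (hO : IsEVDS G O) {st₀ st : State} (h : Inv G m O st₀) {v : Fin n} {r k : ℕ}
    {t : ℕ → Fin n × Fin n} (ht : ∀ i < k + k / m, G.Adj (t i).1 (t i).2)
    (hc : Covers G (st₀.arr 4) v (r + 3) (k + k / m) t)
    (hk : ¬ CanDominate G {w : Fin n | Ball G r v w ∧ st₀.arr 4 w = 0} (k - 1))
    (hv : st₀.arr 4 v = 0) (hst : Committed G v (r + 3) t st₀ (k + k / m) Set.univ st) :
    Inv G m O st where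
  charge := by
    classical
    obtain ⟨X, hX, hcard, hXd⟩ := h.charge
    let Y := O.filter fun e => ∃ w : Fin n, (Ball G r v w ∧ st₀.arr 4 w = 0) ∧ EvDominates G e w
    have hY : k ≤ Y.card := by
      refine le_card_of_not_canDominate
        (show {w : Fin n | Ball G r v w ∧ st₀.arr 4 w = 0}.Nonempty from ⟨v, Ball.self r v, hv⟩) hk
        (fun e he => hO.1 e (Finset.mem_filter.1 he).1) fun w hw => ?_
      obtain ⟨e, he, hd⟩ := hO.2 w
      exact ⟨e, Finset.mem_filter.2 ⟨he, w, hw, hd⟩, hd⟩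
    -- Edges charged earlier dominate marked vertices only, whereas each edge of `Y` dominates an
    -- unmarked one.
    have hdisj : Disjoint X Y := by
      rw [Finset.disjoint_left]
      rintro e he he'
      obtain ⟨w, hw, hd⟩ := (Finset.mem_filter.1 he').2
      exact hXd e he w hd hw.2
    refine ⟨X ∪ Y, Finset.union_subset hX (Finset.filter_subset _ _), ?_, fun e he w hd => ?_⟩
    · rw [Finset.card_union_of_disjoint hdisj, hst.count]
      have := Nat.div_mul_le_self k m
      have := Nat.mul_le_mul_left (m + 1) hY
      nlinarith
    · rw [hst.marked]
      rcases Finset.mem_union.1 he with he | he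
      · exact .inl (hXd e he w hd)
      · obtain ⟨heO, x, hx, hdx⟩ := Finset.mem_filter.1 he
        exact .inr ⟨Set.mem_univ w, hx.1.of_evDominates (hO.1 e heO) hdx hd⟩
  edges := by
    intro i hi
    rw [hst.count] at hi
    by_cases hi' : i < st₀.var 1
    · rw [(hst.old i hi').1, (hst.old i hi').2]
      exact h.edges i hi'
    · obtain ⟨d, rfl⟩ := Nat.exists_eq_add_of_le (not_lt.1 hi')
      exact ⟨_, _, (hst.new d (by omega)).1, (hst.new d (by omega)).2, ht d (by omega)⟩
  dom := by
    intro w hw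
    by_cases hw' : st₀.arr 4 w = 0
    · rw [hst.marked] at hw
      obtain ⟨d, hd, hdom⟩ := hc w ⟨(hw.resolve_left (not_not.2 hw')).2, hw'⟩
      exact ⟨st₀.var 1 + d, by rw [hst.count]; omega, _, _, (hst.new d hd).1,
        (hst.new d hd).2, hdom⟩
    · obtain ⟨i, hi, hdom⟩ := h.dom w hw'
      refine ⟨i, by rw [hst.count]; exact Nat.lt_add_right _ hi, ?_⟩
      rwa [(hst.old i hi).1, (hst.old i hi).2]

/-- The state while the vertex `v` is processed, where `c` was the array of marks before; if `F`
holds then `v` has been dealt with, which is recorded in variable `8`. -/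
structure Processing (G : SimpleGraph (Fin n)) (R m : ℕ) (O : Finset (Sym2 (Fin n))) (c : ℕ → ℕ)
    (v : Fin n) (F : Prop) (st : State) : Prop where
  static : Static G R st
  inv : Inv G m O st
  vertex : st.var 3 = v
  mono : ∀ w : Fin n, c w ≠ 0 → st.arr 4 w ≠ 0
  todo : st.var 8 = 0 → st.arr 4 = c
  done : st.var 8 ≠ 0 → st.arr 4 v ≠ 0
  flag : F → st.var 8 ≠ 0

theorem Processing.setVar {c : ℕ → ℕ} {v : Fin n} {F : Prop} {st : State}
    (h : Processing G R m O c v F st) {x : ℕ} (hx : x = 4 ∨ x = 6 ∨ x = 7 ∨ 10 ≤ x) (k : ℕ) :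
    Processing G R m O c v F (st.setVar x k) where
  static := h.static.setVar (by omega) k
  inv := h.inv.setVar (by omega) k
  vertex := by simpa [show 3 ≠ x by omega] using h.vertex
  mono := h.mono
  todo := by simpa [show 8 ≠ x by omega] using h.todo
  done := by simpa [show 8 ≠ x by omega] using h.done
  flag := by simpa [show 8 ≠ x by omega] using h.flag

theorem Processing.anti {c : ℕ → ℕ} {v : Fin n} {F F' : Prop} {st : State}
    (h : Processing G R m O c v F st) (hF : F' → F) : Processing G R m O c v F' st :=
  { h with flag := fun hF' => h.flag (hF hF') }

theorem Processing.of_done {c : ℕ → ℕ} {v : Fin n} {F : Prop} (F' : Prop) {st : State}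
    (h : Processing G R m O c v F st) (h8 : st.var 8 ≠ 0) : Processing G R m O c v F' st :=
  { h with flag := fun _ => h8 }

/-- Try the radius `3 j` and the optimum `k` for the vertex in variable `3`. -/
def attempt (m j k : ℕ) : Prog :=
  .ite (.var 8) .nop (.seq (.assign 7 (.const 0))
    (.seq (search (k - 1) (leaf 7 (3 * j) (k - 1) .nop))
      (.ite (.var 7) .nop (search (k + k / m)
        (leaf 8 (3 * j + 3) (k + k / m) (commit (3 * j + 3) (k + k / m)))))))

theorem attempt_spec {N : ℕ} (hN : 2 ≤ N) (hn : n ≤ N) (hO : IsEVDS G O) {c : ℕ → ℕ} {v : Fin n}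
    (hv : c v = 0) {j k : ℕ} (hj : 3 * j + 3 ≤ R) (F : Prop) :
    Hoare N (Processing G R m O c v F) (attempt m j k) (12 * (k + k / m) + 19)
      (Processing G R m O c v (F ∨ ¬ CanDominate G {w | Ball G (3 * j) v w ∧ c w = 0} (k - 1) ∧
        CanDominate G {w | Ball G (3 * j + 3) v w ∧ c w = 0} (k + k / m))) := by
  have hdiv : 0 ≤ k / m := Nat.zero_le _
  set Φ := CanDominate G {w | Ball G (3 * j) v w ∧ c w = 0} (k - 1) with hΦ
  set Ψ := CanDominate G {w | Ball G (3 * j + 3) v w ∧ c w = 0} (k + k / m) with hΨ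
  -- Variable `7` is sound for `Φ` throughout; after the search, which supplies `F' = Φ`, it is also
  -- complete and decides `Φ`.
  let J : Prop → State → Prop := fun F' st => Processing G R m O c v F st ∧ st.var 8 = 0 ∧
    (st.var 7 ≠ 0 → Φ) ∧ (F' → st.var 7 ≠ 0)
  have h1 : Hoare N (J False) (search (k - 1) (leaf 7 (3 * j) (k - 1) .nop)) (12 * (k - 1) + 15)
      (J (False ∨ Φ)) := by
    refine search_leaf_spec hN hn (by omega) (by omega) (.inl rfl) (fun F' st h => h.1.static)
      (fun F' st h _ => h.1.todo h.2.1) (fun F' st h => h.1.vertex) ?_ ?_ ?_ False ?_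
    · rintro F' st x y hx ⟨h1, h2, h3, h4⟩
      exact ⟨h1.setVar (by omega) y, by simpa [show 8 ≠ x by omega] using h2,
        by simpa [show 7 ≠ x by omega] using h3, by simpa [show 7 ≠ x by omega] using h4⟩
    · rintro F₁ F₂ st ⟨h1, h2, h3, -⟩ h7
      exact ⟨h1, h2, h3, fun _ => h7⟩
    · rintro F₁ F₂ h st ⟨h1, h2, h3, h4⟩
      exact ⟨h1, h2, h3, fun hF => h4 (h hF)⟩
    · intro t F' ht hc
      refine Hoare.seq (a := 0) (b := 1) hN (.nop hN fun st h => h)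
        (.assign hN (by simp [Expr.cost]) ?_)
        (by omega) (by omega)
      rintro st ⟨⟨h1, h2, -, -⟩, h5, -⟩
      exact ⟨⟨h1.setVar (by omega) _, by simpa using h2, fun _ => ⟨t, ht, hc⟩,
        by simp [Expr.eval]⟩, h5.setVar (by omega) _⟩
  have h2 : ¬ Φ → Hoare N (Processing G R m O c v F) (search (k + k / m)
      (leaf 8 (3 * j + 3) (k + k / m) (commit (3 * j + 3) (k + k / m)))) (12 * (k + k / m) + 15)
      (Processing G R m O c v (F ∨ Ψ)) := by
    intro hk
    refine search_leaf_spec hN hn (by omega) hj (.inr rfl) (fun F' st h => h.static)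
      (fun F' st h => h.todo) (fun F' st h => h.vertex)
      (fun F' st x y hx h => h.setVar (by omega) y)
      (fun F₁ F₂ st h h8 => h.of_done F₂ h8) (fun F₁ F₂ h st hst => hst.anti h) F ?_
    intro t F' ht hc
    refine Hoare.of_forall ?_
    rintro st₀ ⟨h, hH, h8⟩
    have hcov := h.todo h8
    refine Hoare.seq (a := k + k / m + 10) (b := 1) hN (commit_spec hN hn h.static hj h.vertex hH)
      (.assign hN (by simp [Expr.cost]) ?_) (by omega) (by omega)
    intro st hst
    have hinv : Inv G m O st :=
      h.inv.committed hO ht (by rwa [hcov]) (by rwa [hcov]) (by rw [hcov]; exact hv) hst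
    refine ⟨⟨(h.static.congr (hst.vars 0 (by omega) (by omega))
      fun a h1 h2 h4 _ => hst.arrs a h1 h2 h4).setVar (by omega) _,
      hinv.setVar (by omega) _, ?_, ?_,
      by simp [Expr.eval], fun _ => ?_, by simp [Expr.eval]⟩, ?_⟩
    · simpa using (hst.vars 3 (by omega) (by omega)).trans h.vertex
    · exact fun w hw => (hst.marked w).2 (.inl (by rwa [hcov]))
    · exact (hst.marked v).2 (.inr ⟨Set.mem_univ v, Ball.self _ v⟩)
    · refine Holds.setVar (fun i h1 h2 => ?_) (by omega) _
      rw [hst.vars _ (by omega) (by omega), hst.vars _ (by omega) (by omega)]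
      exact hH i h1 h2
  refine (Hoare.ite (a := 12 * (k + k / m) + 18) hN ?_ (.nop hN ?_) (.seq (M := J False) (a := 1)
    (b := 12 * (k + k / m) + 17) hN (.assign hN (by simp [Expr.cost]) ?_) (.seq hN h1
      (.ite (a := 12 * (k + k / m) + 15) hN ?_ (.nop hN ?_) ?_) (by omega) (by omega)) (by omega)
        (by omega))).conseq hN (by omega) (fun _ h => h) fun _ h => h
  · calc (Expr.var 8).cost + 1 ≤ 2 ^ 1 := by simp [Expr.cost]
      _ ≤ _ := Nat.pow_le_pow_right two_pos (by omega)
  · exact fun st h => h.1.of_done _ h.2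
  · exact fun st h => ⟨h.1.setVar (by omega) _, by simpa [Expr.eval] using h.2, by simp [Expr.eval],
      False.elim⟩
  · calc (Expr.var 7).cost + 1 ≤ 2 ^ 1 := by simp [Expr.cost]
      _ ≤ _ := Nat.pow_le_pow_right two_pos (by omega)
  · rintro st ⟨⟨h1, -, h3, -⟩, h7⟩
    exact h1.anti fun hF => hF.resolve_right fun h => h.1 (h3 h7)
  · by_cases hk : Φ
    · rintro st ⟨⟨-, -, -, h⟩, h7⟩
      exact absurd h7 (h (.inr hk))
    · exact (h2 hk).conseq hN le_rfl (fun st h => h.1.1) fun st h =>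
        h.anti (Or.imp_right And.right)

/-- Unless it is marked, process the vertex in variable `3`. -/
def process (m : ℕ) : Prog :=
  .ite (.read 4 (.var 3)) .nop (.seq (.assign 8 (.const 0))
    (seqList ((List.range (numRadii m) ×ˢ List.range (maxSize m + 1)).map
      fun x => attempt m x.1 x.2)))

/-- Some pair in the unrolled list is good by `exists_radius`, so the flag is set by the end and `v`
is marked. The first success freezes all later attempts. -/
theorem process_spec {N : ℕ} (hN : 2 ≤ N) (hn : n ≤ N) (hG : IsUnitDiskGraph G)
    (hiso : ∀ v, ∃ w, G.Adj v w) (hm : 2 ≤ m) (hO : IsEVDS G O) (v : Fin n) (D : Fin n → Prop) :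
    Hoare N (fun st => Static G (3 * numRadii m) st ∧ Inv G m O st ∧
        (∀ w, D w → st.arr 4 w ≠ 0) ∧ st.var 3 = v) (process m)
      (25 * maxSize m + numRadii m + 22)
      (fun st => Static G (3 * numRadii m) st ∧ Inv G m O st ∧
        (∀ w, D w ∨ w = v → st.arr 4 w ≠ 0) ∧ st.var 3 = v) := by
  refine Hoare.of_forall ?_
  rintro st₀ ⟨hs, hi, hD, hv⟩
  set l := List.range (numRadii m) ×ˢ List.range (maxSize m + 1) with hl
  refine (Hoare.ite (a := 25 * maxSize m + numRadii m + 21) hN ?_ (.nop hN ?_) ?_).conseq hN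
    le_rfl (fun _ h => h) fun _ h => h
  · calc (Expr.read 4 (.var 3)).cost + 1 ≤ 2 ^ 2 := by simp [Expr.cost]
      _ ≤ _ := Nat.pow_le_pow_right two_pos (by omega)
  · rintro _ ⟨rfl, h⟩
    refine ⟨hs, hi, fun w hw => ?_, hv⟩
    rcases hw with hw | rfl
    · exact hD w hw
    · simpa [Expr.eval, hv] using h
  · by_cases hc : st₀.arr 4 v = 0
    swap
    · rintro _ ⟨rfl, h⟩
      exact absurd (by simpa [Expr.eval, hv] using h) hc
    let good : ℕ × ℕ → Prop := fun x =>
      ¬ CanDominate G {w : Fin n | Ball G (3 * x.1) v w ∧ st₀.arr 4 w = 0} (x.2 - 1) ∧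
        CanDominate G {w : Fin n | Ball G (3 * x.1 + 3) v w ∧ st₀.arr 4 w = 0} (x.2 + x.2 / m)
    have hgood : ∃ x ∈ l, good x := by
      obtain ⟨j, hj, k, hk, h⟩ := exists_radius hG hiso hm v {w | st₀.arr 4 w = 0} hc
      exact ⟨(j, k), by simp [hl, hj, hk], h⟩
    -- The factor `24` is `12 * 2`, from `k + k / m ≤ 2 * maxSize m`; the length of the list
    -- contributes `numRadii m + maxSize m + 1` to the exponent.
    have hlist := Hoare.seqList (a := 24 * maxSize m + 19) (b := numRadii m + maxSize m + 1) hN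
      (fun x : ℕ × ℕ => attempt m x.1 x.2) l
      (fun l => Processing G (3 * numRadii m) m O (st₀.arr 4) v (∃ x ∈ l, good x)) ?_ ?_
    · refine Hoare.seq (a := 1) hN (.assign hN (by simp [Expr.cost]) ?_) (hlist.conseq hN le_rfl
        (fun _ h => h) ?_) (by omega) (by omega)
      · rintro _ ⟨rfl, -⟩
        exact ⟨hs.setVar (by omega) _, hi.setVar (by omega) _, by simpa using hv, fun _ h => h,
          fun _ => rfl, by simp [Expr.eval], by simp⟩
      · intro st h
        refine ⟨h.static, h.inv, fun w hw => ?_, h.vertex⟩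
        rcases hw with hw | rfl
        · exact h.mono w (hD w hw)
        · exact h.done (h.flag hgood)
    · intro l₁ x l₂ hx
      have hmem : x ∈ l := by rw [hx]; simp
      obtain ⟨hx1, hx2⟩ : x.1 < numRadii m ∧ x.2 < maxSize m + 1 := by
        simpa only [List.mem_range] using List.pair_mem_product.1 hmem
      have hdiv : x.2 / m ≤ x.2 := Nat.div_le_self _ _
      refine (attempt_spec hN hn hO hc (j := x.1) (k := x.2) (by omega) _).conseq hN (by omega)
        (fun _ h => h) fun st h => h.anti ?_
      rintro ⟨y, hy, hgy⟩
      rcases List.mem_append.1 hy with hy | hy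
      · exact .inl ⟨y, hy, hgy⟩
      · obtain rfl : y = x := by simpa using hy
        exact .inr hgy
    · have h1 : numRadii m < 2 ^ numRadii m := Nat.lt_two_pow_self
      have h2 : maxSize m + 1 < 2 ^ (maxSize m + 1) := Nat.lt_two_pow_self
      have h3 : l.length = numRadii m * (maxSize m + 1) := by
        rw [hl]; exact (List.length_product _ _).trans (by simp)
      rw [h3, add_assoc, pow_add]
      exact Nat.mul_lt_mul'' h1 h2

/-- The approximation algorithm with the growth rate `1 + 1 / m`. -/
def approx (m : ℕ) : Prog :=
  .seq initProg (.seq (seqList ((List.range (3 * numRadii m)).map ballStep)) (forLt 3 (process m)))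

/-- The set `O` occurs only in the analysis: the program does not depend on it, and any EVDS may be
compared with the output. -/
theorem approx_spec {N : ℕ} (hN : 2 ≤ N) (hn : n ≤ N) (hG : IsUnitDiskGraph G)
    (hiso : ∀ v, ∃ w, G.Adj v w) (hm : 2 ≤ m) (hO : IsEVDS G O) :
    Hoare N (fun st => st = inputState G) (approx m) (25 * maxSize m + 3 * numRadii m + 30)
      (fun st => Inv G m O st ∧ ∀ w : Fin n, st.arr 4 w ≠ 0) := by
  refine Hoare.seq hN (initProg_spec hN hn) (.seq hN (Hoare.seqList (a := 21)
    (b := 3 * numRadii m) hN ballStep _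
    (fun l st => Static G l.length st ∧ Fresh l.length st) ?_ (by simpa using Nat.lt_two_pow_self))
    ((Hoare.forLt hN hn (fun j st => Static G (3 * numRadii m) st ∧ Inv G m O st ∧
      ∀ w : Fin n, w < j → st.arr 4 w ≠ 0) (fun j st h => h.1.size) ?_
      (fun v => (process_spec hN hn hG hiso hm hO v fun w => w < v).conseq hN le_rfl ?_ ?_)).conseq
        hN le_rfl ?_ fun st h => ⟨h.2.1, fun w => h.2.2 w w.isLt⟩)
      (c := 25 * maxSize m + 3 * numRadii m + 29) ?_ ?_) ?_ ?_
  · intro l₁ x l₂ h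
    have hx : x = l₁.length := by
      have := congrArg (fun l => l[l₁.length]?) h
      simp only [List.getElem?_append_right le_rfl, Nat.sub_self, List.getElem?_cons_zero] at this
      rw [List.getElem?_eq_some_iff] at this
      obtain ⟨_, h⟩ := this
      simpa using h.symm
    subst hx
    simpa using ballStep_spec hN hn
  · exact fun j st k h => ⟨h.1.setVar (by omega) k, h.2.1.setVar (by omega) k, h.2.2⟩
  · exact fun st h => ⟨h.1.1, h.1.2.1, fun w hw => h.1.2.2 w hw, h.2⟩
  · refine fun st h => ⟨⟨h.1, h.2.1, fun w hw => h.2.2.1 w ?_⟩, h.2.2.2⟩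
    rcases Nat.lt_succ_iff_lt_or_eq.1 hw with hw | hw
    · exact .inl hw
    · exact .inr (Fin.ext hw)
  · rintro st ⟨hs, hf⟩
    rw [List.length_range] at hs hf
    refine ⟨hs, ⟨⟨∅, by simp, by simp [hf.count], by simp⟩, ?_, ?_⟩, by simp⟩
    · intro i hi
      rw [hf.count] at hi
      omega
    · exact fun w hw => absurd (hf.covered w) hw
  all_goals omega

end

end RAM

/-! ### Reading off the solution and estimating the exponent -/

open RAM in
theorem exists_output {n : ℕ} {G : SimpleGraph (Fin n)} {m : ℕ} {O : Finset (Sym2 (Fin n))}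
    {st : State} (h : Inv G m O st) (hall : ∀ w : Fin n, st.arr 4 w ≠ 0) :
    ∃ S : Finset (Sym2 (Fin n)), st.Outputs S ∧ IsEVDS G S ∧ S.card * m ≤ (m + 1) * O.card := by
  choose a b ha hb hab using fun i : Fin (st.var 1) => h.edges i i.isLt
  refine ⟨Finset.univ.image fun i => s(a i, b i), ⟨fun i => (a i, b i), fun i => ⟨ha i, hb i⟩, ?_⟩,
    ⟨?_, fun w => ?_⟩, ?_⟩
  · simp [eq_comm]
  · intro e he
    obtain ⟨i, -, rfl⟩ := Finset.mem_image.1 he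
    exact hab i
  · obtain ⟨i, hi, a', b', ha', hb', hd⟩ := h.dom w (hall w)
    have h1 : a ⟨i, hi⟩ = a' := Fin.ext ((ha ⟨i, hi⟩).symm.trans ha')
    have h2 : b ⟨i, hi⟩ = b' := Fin.ext ((hb ⟨i, hi⟩).symm.trans hb')
    subst h1 h2
    exact ⟨_, Finset.mem_image_of_mem _ (Finset.mem_univ ⟨i, hi⟩), (evDominates_iff (hab _)).2 hd⟩
  · obtain ⟨X, hX, hcard, -⟩ := h.charge
    -- The output list may repeat edges, which only makes `S` smaller.
    have h1 : (Finset.univ.image fun i => s(a i, b i)).card ≤ st.var 1 := by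
      simpa using Finset.card_image_le (s := Finset.univ) (f := fun i => s(a i, b i))
    calc _ ≤ st.var 1 * m := Nat.mul_le_mul_right m h1
      _ ≤ (m + 1) * X.card := hcard
      _ ≤ (m + 1) * O.card := Nat.mul_le_mul_left _ (Finset.card_le_card hX)

theorem exists_evds_card_eq {V : Type*} [Finite V] {G : SimpleGraph V}
    (hiso : ∀ v, ∃ w, G.Adj v w) :
    ∃ S : Finset (Sym2 V), IsEVDS G S ∧ S.card = evDominationNumber G := by
  refine Nat.sInf_mem (s := {k : ℕ | ∃ S : Finset (Sym2 V), IsEVDS G S ∧ S.card = k}) ?_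
  refine ⟨_, (Set.toFinite G.edgeSet).toFinset, ⟨by simp, fun v => ?_⟩, rfl⟩
  obtain ⟨w, hw⟩ := hiso v
  exact ⟨s(v, w), by simpa using hw, .inl (Sym2.mem_mk_left v w)⟩

/-- The exponent of the running time is quadratic in `(1 / ε) log (1 / ε)`. -/
theorem exponent_le {ε : ℝ} (hε : 0 < ε) :
    ((max 2 ⌈1 / ε⌉₊ * (Nat.log 2 (max 2 ⌈1 / ε⌉₊) + 1) : ℕ) : ℝ) ^ 2 ≤
      81 * (1 + (1 / ε * Real.log (1 / ε)) ^ 2) := by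
  have hlog2 := Real.log_two_gt_d9
  -- For `m = 2` the left side is `16`, covered by the summand `1`; this summand is needed because
  -- `c` vanishes at `ε = 1`. Otherwise `1 / ε > 2`, and both `m` and `Nat.log 2 m + 1` are bounded
  -- by multiples of `x` and `Real.log x`.
  rcases le_or_gt ⌈1 / ε⌉₊ 2 with h | h
  · have : Nat.log 2 2 = 1 := by norm_num
    rw [max_eq_left h, this]
    have := sq_nonneg (1 / ε * Real.log (1 / ε))
    norm_num
    norm_num at this
    linarith
  · rw [max_eq_right h.le]
    set x := 1 / ε with hx
    have hx2 : 2 < x := by simpa using Nat.lt_ceil.1 h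
    have hx0 : 0 ≤ x := by linarith
    have hmx : (⌈x⌉₊ : ℝ) ≤ 3 / 2 * x := by linarith [Nat.ceil_lt_add_one hx0]
    set m := ⌈x⌉₊ with hm
    have hm0 : (0 : ℝ) < m := by exact_mod_cast (by omega : 0 < m)
    have hL : (Nat.log 2 m : ℝ) * Real.log 2 ≤ Real.log m := by
      rw [← Real.log_pow]
      refine Real.log_le_log (by positivity) ?_
      exact_mod_cast Nat.pow_log_le_self 2 (by omega)
    have hlogm : Real.log m ≤ 2 * Real.log x := by
      rw [← Nat.cast_two, ← Real.log_pow]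
      refine Real.log_le_log hm0 ?_
      nlinarith
    have hlogx : Real.log 2 ≤ Real.log x := Real.log_le_log two_pos hx2.le
    have hL' : (Nat.log 2 m : ℝ) + 1 ≤ 6 * Real.log x := by
      have hn : (0 : ℝ) ≤ Nat.log 2 m := by positivity
      nlinarith
    have hprod : (m : ℝ) * (Nat.log 2 m + 1) ≤ 9 * (x * Real.log x) := by
      calc (m : ℝ) * (Nat.log 2 m + 1) ≤ 3 / 2 * x * (6 * Real.log x) := by gcongr
        _ = 9 * (x * Real.log x) := by ring
    push_cast
    calc ((m : ℝ) * (Nat.log 2 m + 1)) ^ 2 ≤ (9 * (x * Real.log x)) ^ 2 := by gcongr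
      _ ≤ 81 * (1 + (x * Real.log x) ^ 2) := by nlinarith

theorem time_exponent_le (m : ℕ) (hm : 1 ≤ m) :
    25 * maxSize m + 3 * numRadii m + 30 ≤ 2000000 * (m * (Nat.log 2 m + 1)) ^ 2 := by
  have h1 : 1 ≤ m * (Nat.log 2 m + 1) := Nat.mul_pos hm (Nat.succ_pos _)
  simp only [maxSize, numRadii]
  nlinarith

theorem mainTheorem2 :
    ∃ C : ℝ, 0 < C ∧ ∀ ε : ℝ, 0 < ε → ∃ P : RAM.Prog,
      ∀ (n : ℕ) (G : SimpleGraph (Fin n)), IsUnitDiskGraph G → (∀ v, ∃ w, G.Adj v w) →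
        ∃ (S : Finset (Sym2 (Fin n))) (t : ℕ),
          RAM.Computes P G S t ∧
          IsEVDS G S ∧
          (S.card : ℝ) ≤ (1 + ε) * (evDominationNumber G : ℝ) ∧
          (t : ℝ) ≤ (max n 2 : ℝ) ^ (C * (1 + (1 / ε * Real.log (1 / ε)) ^ 2)) := by
  -- The constant is the product of the factors in `time_exponent_le` and `exponent_le`.
  refine ⟨2000000 * 81, by norm_num, fun ε hε => ?_⟩
  set m := max 2 ⌈1 / ε⌉₊ with hm
  have hm2 : 2 ≤ m := le_max_left _ _
  refine ⟨RAM.approx m, fun n G hG hiso => ?_⟩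
  obtain ⟨O, hO, hOcard⟩ := exists_evds_card_eq hiso
  obtain ⟨st, t, hexec, ht, hinv, hall⟩ := RAM.approx_spec (N := max n 2) (le_max_right _ _)
    (le_max_left _ _) hG hiso hm2 hO _ rfl
  obtain ⟨S, hout, hS, hcard⟩ := exists_output hinv hall
  refine ⟨S, t, ⟨st, hexec, hout⟩, hS, ?_, ?_⟩
  · have hm0 : (0 : ℝ) < m := by exact_mod_cast (by omega : 0 < m)
    have hmε : 1 ≤ ε * m := by
      have h1 : 1 / ε ≤ m := (Nat.le_ceil _).trans (by exact_mod_cast le_max_right _ _)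
      rwa [div_le_iff₀' hε] at h1
    have hcard' : (S.card : ℝ) * m ≤ (m + 1) * evDominationNumber G := by
      rw [← hOcard]; exact_mod_cast hcard
    refine le_of_mul_le_mul_right (hcard'.trans ?_) hm0
    have : (0 : ℝ) ≤ evDominationNumber G := Nat.cast_nonneg _
    nlinarith
  · have h1 : (1 : ℝ) ≤ max (n : ℝ) 2 := one_le_two.trans (le_max_right _ _)
    calc (t : ℝ) ≤ ((max n 2 : ℕ) : ℝ) ^ (25 * maxSize m + 3 * numRadii m + 30) := by
          exact_mod_cast ht
      _ = (max n 2 : ℝ) ^ ((25 * maxSize m + 3 * numRadii m + 30 : ℕ) : ℝ) := by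
          rw [Real.rpow_natCast]; push_cast; rfl
      _ ≤ _ := by
          refine Real.rpow_le_rpow_of_exponent_le h1 ?_
          have h2 : ((25 * maxSize m + 3 * numRadii m + 30 : ℕ) : ℝ) ≤
              2000000 * ((m * (Nat.log 2 m + 1) : ℕ) : ℝ) ^ 2 := by
            exact_mod_cast time_exponent_le m (by omega)
          have h3 := exponent_le hε
          rw [← hm] at h3
          linarith
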